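/- Let $G$ be a finite simple graph. Two sets *overlap* if they intersect and neither contains the other. A *finite overlap representation* of $G$ is an assignment $f$ of a finite set $f(v)$ to each vertex $v$ such that vertices $u$ and $v$ are adjacent if and only if $f(u)$ and $f(v)$ overlap; its *size* is $\left|\bigcup_{v\in V(G)} f(v)\right|$. The *overlap number* $\varphi(G)$ is the minimum size of a finite overlap representation of $G$. **Theorem.** If $G$ has $n$ vertices and $n\ge 14$, then $$\varphi(G)\le\left\lfloor \frac{n^2}{4}-\frac n2-1\right\rfloor .$$ -/

import Mathlib

/-- Two sets overlap if they intersect and neither contains the other. -/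
def Overlaps {α : Type*} (A B : Finset α) : Prop :=
  (∃ a, a ∈ A ∧ a ∈ B) ∧ ¬ A ⊆ B ∧ ¬ B ⊆ A

/-- A finite overlap representation of `G`, with labels in `α`: an assignment of finite sets to the
vertices such that `u` and `v` are adjacent exactly when their sets overlap. The sets need not be
distinct (a set never overlaps itself, so the condition is vacuous for `u = v`). -/
def IsOverlapRepresentation {V α : Type*} (G : SimpleGraph V) (f : V → Finset α) : Prop :=
  ∀ u v : V, G.Adj u v ↔ Overlaps (f u) (f v)

/-- The size of a representation: the number of elements in the union of the assigned sets. -/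
def representationSize {V α : Type*} [Fintype V] [DecidableEq α] (f : V → Finset α) : ℕ :=
  (Finset.univ.biUnion f).card

/-- The overlap number: the minimum size of a finite overlap representation. Only the number of
labels matters, so the labels are taken from `ℕ`. The set of sizes is nonempty by
`exists_isOverlapRepresentation`, so the infimum is attained. -/
noncomputable def overlapNumber {V : Type*} [Fintype V] (G : SimpleGraph V) : ℕ :=
  sInf {k : ℕ | ∃ f : V → Finset ℕ, IsOverlapRepresentation G f ∧ representationSize f = k}

/-- Every finite graph has a finite overlap representation: use one label for each edge and one
private label for each vertex. -/
theorem exists_isOverlapRepresentation {V : Type*} [Fintype V] (G : SimpleGraph V) :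
    ∃ f : V → Finset ℕ, IsOverlapRepresentation G f := by
  classical
  let e : Sym2 V ↪ ℕ := (Fintype.equivFin (Sym2 V)).toEmbedding.trans Fin.valEmbedding
  let g : V → Finset (Sym2 V) := fun v =>
    Finset.univ.filter fun x => v ∈ x ∧ (x ∈ G.edgeSet ∨ x = s(v, v))
  have hself : ∀ u v : V, u ≠ v → ¬ g u ⊆ g v := by
    intro u v huv h
    have h1 : s(u, u) ∈ g u := by simp [g]
    have h2 := h h1
    simp [g, huv.symm] at h2
  refine ⟨fun v => (g v).map e, fun u v => ?_⟩
  constructor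
  · intro h
    refine ⟨⟨e s(u, v), ?_, ?_⟩, ?_, ?_⟩
    · simp [g, h]
    · simp [g, h]
    · rw [Finset.map_subset_map]
      exact hself u v h.ne
    · rw [Finset.map_subset_map]
      exact hself v u h.ne'
  · rintro ⟨⟨a, ha, hb⟩, hc, -⟩
    obtain ⟨x, hx, rfl⟩ := Finset.mem_map.1 ha
    have hy : x ∈ g v := (Finset.mem_map' e).1 hb
    have huv : u ≠ v := by
      rintro rfl
      exact hc (Finset.Subset.refl _)
    simp only [g, Finset.mem_filter, Finset.mem_univ, true_and] at hx hy
    have hxe : x = s(u, v) := (Sym2.mem_and_mem_iff huv).1 ⟨hx.1, hy.1⟩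
    subst hxe
    rcases hx.2 with h | h
    · exact h
    · exact absurd (by simpa using h) huv.symm

/-- The minimum that defines the overlap number is attained. -/
theorem exists_representationSize_eq_overlapNumber {V : Type*} [Fintype V] (G : SimpleGraph V) :
    ∃ f : V → Finset ℕ, IsOverlapRepresentation G f ∧ representationSize f = overlapNumber G := by
  obtain ⟨f, hf⟩ := exists_isOverlapRepresentation G
  exact Nat.sInf_mem (s := {k : ℕ | ∃ f : V → Finset ℕ,
    IsOverlapRepresentation G f ∧ representationSize f = k}) ⟨_, f, hf, rfl⟩

/-!
Throughout, `b n = n (n - 2) / 4 - 1` (rounded down) is the claimed bound.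

The basic tool is a *separating clique cover*: a family of cliques covering all edges such that of
two adjacent vertices each lies in a member avoiding the other. Giving each vertex the members that
contain it yields an overlap representation without inclusions (`HasSepCover.overlapNumber_le`).
Such covers are built as in the theorem of Erdős, Goodman and Pósa, by adding a clique `K` at a time
at the cost of one new member for each vertex attached to `K` (`hasSepCover_of_clique`). They have at
most `n ^ 2 / 4` members from eight vertices on (`hasSepCover_sq_div_four`), and each triangle used
in the construction saves about `n / 2`. So a 4-clique or two disjoint triangles suffice.

In the remaining cases true overlap representations are needed, that is, inclusions. They save labels
in three ways. Twins receive the same set, so they may be assumed absent by induction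
(`overlapNumber_le_of_twins`). If `N(w) ⊆ N(u)`, then `w` receives a subset of the set of `u`
(`overlapNumber_le_of_dominated`). The last clique to be added may receive almost all labels, so that
its vertices contain their non-neighbours, which saves the labels for the edges inside the clique
(`overlapNumber_le_of_last_clique`).

For a triangle-free graph in which no neighbourhood contains another one, the degrees of adjacent
vertices add up to at most `n - 2`, so there are at most `n (n - 2) / 4` edges, and the last edge is
free. If `N(w) ⊆ N(u)`, deleting `w` leaves fewer than `b n` edges, since a graph with nearly
`(n - 1) ^ 2 / 4` edges contains many vertices with the same neighbourhood
(`TriangleFreeOn.exists_common_nbrs`), two of which would be twins in the whole graph. Finally, if the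
graph becomes triangle-free by deleting a triangle `K` and has no 4-clique, then `K` is added last.
When this is too expensive, the rest is again nearly extremal, with at least six vertices having the
same neighbourhood up to few exceptions. They are told apart by their neighbours in `K`, and counting
the possible sets of neighbours gives a contradiction (`overlapNumber_le_of_triangle`).
-/

namespace OverlapBound

open Finset

/-! ### Sets of neighbours in a triangle -/

/-- Sets `T` of neighbours in a triangle, when every vertex outside the triangle adjacent to `yᵢ` is
also adjacent to `xᵢ`. -/
theorem card_types_le : ∀ x₁ y₁ x₂ y₂ : Fin 3, x₁ ≠ y₁ → x₂ ≠ y₂ → x₁ ≠ x₂ →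
    #{T : Finset (Fin 3) | T ≠ ∅ ∧ T ≠ univ ∧ (y₁ ∈ T → x₁ ∈ T) ∧ (y₂ ∈ T → x₂ ∈ T)} ≤ 3 := by
  decide

theorem card_types_le' : ∀ x y : Fin 3, x ≠ y →
    #{T : Finset (Fin 3) | T ≠ ∅ ∧ T ≠ univ ∧ (y ∈ T → x ∈ T)} ≤ 4 := by
  decide

theorem card_types : #{T : Finset (Fin 3) | T ≠ ∅ ∧ T ≠ univ} = 6 := by
  decide

/-- If the neighbourhood of each vertex `x` of a triangle contains that of another vertex `y x`, then
some cycle of `y` consists of vertices with the same neighbours, which must be absent if no vertex is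
adjacent to the whole triangle. So at most one vertex `c` of the triangle has outer neighbours. -/
theorem exists_subset_singleton_of_types : ∀ y : Fin 3 → Fin 3, (∀ x, y x ≠ x) →
    ∃ c, ∀ T : Finset (Fin 3), T ≠ univ → (∀ x, y x ∈ T → x ∈ T) → T ⊆ {c} := by
  decide

theorem exists_other_two : ∀ c : Fin 3, ∃ a b : Fin 3, a ≠ c ∧ b ≠ c ∧ a ≠ b := by
  decide

open scoped Classical

/-! ### Representations from incidence relations -/

/-- A representation may be given by a finite set `L` of labels and a relation telling which vertex
carries which label. -/
theorem overlapNumber_le_card {V α : Type*} [Fintype V] [Countable α] {G : SimpleGraph V}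
    (L : Finset α) (M : V → α → Prop)
    (hmeet : ∀ u v, G.Adj u v → ∃ a ∈ L, M u a ∧ M v a)
    (hsep : ∀ u v, G.Adj u v → ∃ a ∈ L, M u a ∧ ¬ M v a)
    (hnon : ∀ u v, u ≠ v → ¬ G.Adj u v → (∀ a ∈ L, M u a → ¬ M v a) ∨
      (∀ a ∈ L, M u a → M v a) ∨ (∀ a ∈ L, M v a → M u a)) :
    overlapNumber G ≤ #L := by
  obtain ⟨e, he⟩ := exists_injective_nat α
  let f : V → Finset ℕ := fun v => {a ∈ L | M v a}.image e
  have hmem : ∀ v, ∀ a ∈ L, e a ∈ f v ↔ M v a := by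
    intro v a ha
    simp only [f, mem_image, mem_filter]
    constructor
    · rintro ⟨b, hb, hba⟩
      exact he hba ▸ hb.2
    · exact fun h => ⟨a, ⟨ha, h⟩, rfl⟩
  have hmem' : ∀ v, ∀ k ∈ f v, ∃ a ∈ L, e a = k ∧ M v a := by
    intro v k hk
    obtain ⟨a, ha, rfl⟩ := mem_image.1 hk
    exact ⟨a, (mem_filter.1 ha).1, rfl, (mem_filter.1 ha).2⟩
  have hrep : IsOverlapRepresentation G f := by
    intro u v
    constructor
    · intro h
      refine ⟨?_, fun hs => ?_, fun hs => ?_⟩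
      · obtain ⟨a, ha, hu, hv⟩ := hmeet u v h
        exact ⟨e a, (hmem u a ha).2 hu, (hmem v a ha).2 hv⟩
      · obtain ⟨a, ha, hu, hv⟩ := hsep u v h
        exact hv ((hmem v a ha).1 (hs ((hmem u a ha).2 hu)))
      · obtain ⟨a, ha, hu, hv⟩ := hsep v u h.symm
        exact hv ((hmem u a ha).1 (hs ((hmem v a ha).2 hu)))
    · rintro ⟨⟨k, hku, hkv⟩, h1, h2⟩
      by_contra hadj
      have huv : u ≠ v := by
        rintro rfl
        exact h1 (Subset.refl _)
      rcases hnon u v huv hadj with h | h | h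
      · obtain ⟨a, ha, rfl, hu⟩ := hmem' u k hku
        exact h a ha hu ((hmem v a ha).1 hkv)
      · refine h1 fun j hj => ?_
        obtain ⟨a, ha, rfl, hu⟩ := hmem' u j hj
        exact (hmem v a ha).2 (h a ha hu)
      · refine h2 fun j hj => ?_
        obtain ⟨a, ha, rfl, hu⟩ := hmem' v j hj
        exact (hmem u a ha).2 (h a ha hu)
  calc overlapNumber G ≤ representationSize f := Nat.sInf_le ⟨f, hrep, rfl⟩
    _ ≤ #(L.image e) := by
      refine card_le_card (biUnion_subset.2 fun v _ => image_subset_image (filter_subset _ _))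
    _ ≤ #L := card_image_le

/-- Two vertices with the same neighbourhood may receive the same set, so one of them is free. -/
theorem overlapNumber_le_of_twins {V : Type*} [Fintype V] {G : SimpleGraph V} {u v : V}
    (huv : u ≠ v) (h : ∀ x, G.Adj u x ↔ G.Adj v x) :
    overlapNumber G ≤ overlapNumber (G.comap (Subtype.val : {x // x ≠ v} → V)) := by
  obtain ⟨f, hf, hsize⟩ := exists_representationSize_eq_overlapNumber
    (G.comap (Subtype.val : {x // x ≠ v} → V))
  let r : V → {x // x ≠ v} := fun x => if hx : x = v then ⟨u, huv⟩ else ⟨x, hx⟩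
  have hr : ∀ x y, G.Adj x y ↔ G.Adj (r x).1 (r y).1 := by
    intro x y
    by_cases hx : x = v <;> by_cases hy : y = v <;> simp [r, hx, hy, h]
    rw [G.adj_comm, ← h, G.adj_comm]
  refine le_trans (Nat.sInf_le ⟨f ∘ r, fun x y => ?_, rfl⟩) (le_trans ?_ hsize.le)
  · rw [hr x y]
    exact hf (r x) (r y)
  · refine card_le_card (biUnion_subset.2 fun x _ => ?_)
    exact subset_biUnion_of_mem f (mem_univ (r x))

/-! ### Clique covers that separate adjacent vertices -/

variable {V : Type*} {G : SimpleGraph V}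

/-- A separating clique cover of `S`: a family of cliques inside `S` that covers every edge and
every vertex of `S`, such that of two adjacent vertices each lies in a member avoiding the other.
Assigning to each vertex the members containing it gives an overlap representation of the graph
induced on `S` in which no set contains another. -/
structure IsSepCover (G : SimpleGraph V) (S : Finset V) (𝒞 : Finset (Finset V)) : Prop where
  subset : ∀ C ∈ 𝒞, C ⊆ S
  clique : ∀ C ∈ 𝒞, ∀ x ∈ C, ∀ y ∈ C, x ≠ y → G.Adj x y
  cover : ∀ x ∈ S, ∀ y ∈ S, G.Adj x y → ∃ C ∈ 𝒞, x ∈ C ∧ y ∈ C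
  sep : ∀ x ∈ S, ∀ y ∈ S, G.Adj x y → ∃ C ∈ 𝒞, x ∈ C ∧ y ∉ C
  mem : ∀ x ∈ S, ∃ C ∈ 𝒞, x ∈ C

/-- `S` has a separating clique cover with at most `k` members. -/
def HasSepCover (G : SimpleGraph V) (S : Finset V) (k : ℕ) : Prop :=
  ∃ 𝒞, IsSepCover G S 𝒞 ∧ #𝒞 ≤ k

theorem HasSepCover.mono {S : Finset V} {k l : ℕ} (h : HasSepCover G S k) (hkl : k ≤ l) :
    HasSepCover G S l := by
  obtain ⟨𝒞, h𝒞, hk⟩ := h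
  exact ⟨𝒞, h𝒞, hk.trans hkl⟩

theorem hasSepCover_empty : HasSepCover G ∅ 0 :=
  ⟨∅, ⟨by simp, by simp, by simp, by simp, by simp⟩, by simp⟩

theorem HasSepCover.overlapNumber_le [Fintype V] {k : ℕ} (h : HasSepCover G univ k) :
    overlapNumber G ≤ k := by
  obtain ⟨𝒞, h𝒞, hk⟩ := h
  refine le_trans (overlapNumber_le_card 𝒞 (fun v C => v ∈ C) ?_ ?_ ?_) hk
  · exact fun u v h => h𝒞.cover u (mem_univ _) v (mem_univ _) h
  · exact fun u v h => h𝒞.sep u (mem_univ _) v (mem_univ _) h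
  · exact fun u v huv h => Or.inl fun C hC hu hv => h (h𝒞.clique C hC u hu v hv huv)

/-- The vertices of `S` having a neighbour in `K`. -/
noncomputable def attached (G : SimpleGraph V) (S K : Finset V) : Finset V :=
  {w ∈ S | ∃ x ∈ K, G.Adj x w}

theorem mem_attached {S K : Finset V} {w : V} :
    w ∈ attached G S K ↔ w ∈ S ∧ ∃ x ∈ K, G.Adj x w := mem_filter

theorem attached_subset (G : SimpleGraph V) (S K : Finset V) : attached G S K ⊆ S :=
  filter_subset _ _

/-- Adding a clique `K` to a separating clique cover: one new member `{w} ∪ (N(w) ∩ K)` for each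
vertex `w` attached to `K`, and a family `ℰ` of subsets of `K` that repairs what is then still
missing inside `K`. -/
theorem hasSepCover_of_clique {S K : Finset V} {k : ℕ} (hKS : K ⊆ S)
    (hK : ∀ x ∈ K, ∀ y ∈ K, x ≠ y → G.Adj x y) (h : HasSepCover G (S \ K) k)
    (ℰ : Finset (Finset V)) (hℰ : ∀ E ∈ ℰ, E ⊆ K)
    (hcover : ∀ x ∈ K, ∀ y ∈ K, x ≠ y →
      (∃ E ∈ ℰ, x ∈ E ∧ y ∈ E) ∨ ∃ w ∈ S \ K, G.Adj x w ∧ G.Adj y w)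
    (hsep : ∀ x ∈ K, ∀ y ∈ K, x ≠ y →
      (∃ E ∈ ℰ, x ∈ E ∧ y ∉ E) ∨ ∃ w ∈ S \ K, G.Adj x w ∧ ¬ G.Adj y w)
    (hout : ∀ x ∈ K, (∃ E ∈ ℰ, x ∈ E) ∨
      ∃ w ∈ S \ K, ∃ w' ∈ S \ K, w ≠ w' ∧ G.Adj x w ∧ G.Adj x w') :
    HasSepCover G S (k + #(attached G (S \ K) K) + #ℰ) := by
  obtain ⟨𝒞, h𝒞, hk⟩ := h
  let N : V → Finset V := fun w => insert w {x ∈ K | G.Adj x w}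
  have hN : ∀ w x, x ∈ N w ↔ x = w ∨ x ∈ K ∧ G.Adj x w := fun w x => by simp [N]
  let 𝒩 : Finset (Finset V) := (attached G (S \ K) K).image N
  have h𝒩 : ∀ w ∈ S \ K, ∀ x ∈ K, G.Adj x w → N w ∈ 𝒩 := fun w hw x hx hxw =>
    mem_image_of_mem _ (mem_attached.2 ⟨hw, x, hx, hxw⟩)
  have hnotK : ∀ w ∈ S \ K, w ∉ K := fun w hw => (mem_sdiff.1 hw).2
  refine ⟨𝒞 ∪ 𝒩 ∪ ℰ, ⟨?_, ?_, ?_, ?_, ?_⟩, ?_⟩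
  · intro C hC
    rcases mem_union.1 hC with hC | hC
    · rcases mem_union.1 hC with hC | hC
      · exact (h𝒞.subset C hC).trans sdiff_subset
      · obtain ⟨w, hw, rfl⟩ := mem_image.1 hC
        intro x hx
        rcases (hN w x).1 hx with rfl | hx
        · exact (mem_sdiff.1 (mem_attached.1 hw).1).1
        · exact hKS hx.1
    · exact (hℰ C hC).trans hKS
  · intro C hC x hx y hy hxy
    rcases mem_union.1 hC with hC | hC
    · rcases mem_union.1 hC with hC | hC
      · exact h𝒞.clique C hC x hx y hy hxy
      · obtain ⟨w, hw, rfl⟩ := mem_image.1 hC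
        rcases (hN w x).1 hx with rfl | hx <;> rcases (hN _ y).1 hy with rfl | hy
        · exact absurd rfl hxy
        · exact hy.2.symm
        · exact hx.2
        · exact hK x hx.1 y hy.1 hxy
    · exact hK x (hℰ C hC hx) y (hℰ C hC hy) hxy
  · intro x hx y hy hxy
    by_cases hxK : x ∈ K <;> by_cases hyK : y ∈ K
    · rcases hcover x hxK y hyK hxy.ne with ⟨E, hE, h⟩ | ⟨w, hw, h1, h2⟩
      · exact ⟨E, by simp [hE], h⟩
      · exact ⟨N w, by simp [h𝒩 w hw x hxK h1], (hN w x).2 (.inr ⟨hxK, h1⟩),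
          (hN w y).2 (.inr ⟨hyK, h2⟩)⟩
    · exact ⟨N y, by simp [h𝒩 y (mem_sdiff.2 ⟨hy, hyK⟩) x hxK hxy],
        (hN y x).2 (.inr ⟨hxK, hxy⟩), (hN y y).2 (.inl rfl)⟩
    · exact ⟨N x, by simp [h𝒩 x (mem_sdiff.2 ⟨hx, hxK⟩) y hyK hxy.symm],
        (hN x x).2 (.inl rfl), (hN x y).2 (.inr ⟨hyK, hxy.symm⟩)⟩
    · obtain ⟨C, hC, h⟩ := h𝒞.cover x (mem_sdiff.2 ⟨hx, hxK⟩) y (mem_sdiff.2 ⟨hy, hyK⟩) hxy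
      exact ⟨C, by simp [hC], h⟩
  · intro x hx y hy hxy
    by_cases hxK : x ∈ K <;> by_cases hyK : y ∈ K
    · rcases hsep x hxK y hyK hxy.ne with ⟨E, hE, h⟩ | ⟨w, hw, h1, h2⟩
      · exact ⟨E, by simp [hE], h⟩
      · refine ⟨N w, by simp [h𝒩 w hw x hxK h1], (hN w x).2 (.inr ⟨hxK, h1⟩), fun hyw => ?_⟩
        rcases (hN w y).1 hyw with rfl | h
        · exact hnotK y hw hyK
        · exact h2 h.2
    · have key : ∀ w ∈ S \ K, w ≠ y → y ∉ N w := fun w _ hwy hyw => by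
        rcases (hN w y).1 hyw with rfl | h
        · exact hwy rfl
        · exact hyK h.1
      rcases hout x hxK with ⟨E, hE, h⟩ | ⟨w, hw, w', hw', hne, h1, h2⟩
      · exact ⟨E, by simp [hE], h, fun hyE => hyK (hℰ E hE hyE)⟩
      · by_cases hwy : w = y
        · exact ⟨N w', by simp [h𝒩 w' hw' x hxK h2], (hN w' x).2 (.inr ⟨hxK, h2⟩),
            key w' hw' (hwy ▸ hne.symm)⟩
        · exact ⟨N w, by simp [h𝒩 w hw x hxK h1], (hN w x).2 (.inr ⟨hxK, h1⟩), key w hw hwy⟩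
    · obtain ⟨C, hC, h⟩ := h𝒞.mem x (mem_sdiff.2 ⟨hx, hxK⟩)
      exact ⟨C, by simp [hC], h, fun hy' => hnotK y (h𝒞.subset C hC hy') hyK⟩
    · obtain ⟨C, hC, h⟩ := h𝒞.sep x (mem_sdiff.2 ⟨hx, hxK⟩) y (mem_sdiff.2 ⟨hy, hyK⟩) hxy
      exact ⟨C, by simp [hC], h⟩
  · intro x hx
    by_cases hxK : x ∈ K
    · rcases hout x hxK with ⟨E, hE, h⟩ | ⟨w, hw, -, -, -, h1, -⟩
      · exact ⟨E, by simp [hE], h⟩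
      · exact ⟨N w, by simp [h𝒩 w hw x hxK h1], (hN w x).2 (.inr ⟨hxK, h1⟩)⟩
    · obtain ⟨C, hC, h⟩ := h𝒞.mem x (mem_sdiff.2 ⟨hx, hxK⟩)
      exact ⟨C, by simp [hC], h⟩
  · have h1 := card_union_le (𝒞 ∪ 𝒩) ℰ
    have h2 := card_union_le 𝒞 𝒩
    have h3 : #𝒩 ≤ #(attached G (S \ K) K) := card_image_le
    omega

/-- A clique `K` with at least three vertices can be added at the cost of `|S|` new members: the
complements of single vertices in `K` form an intersecting antichain. -/
theorem hasSepCover_of_three_le_card {S K : Finset V} {k : ℕ} (hKS : K ⊆ S) (h3 : 3 ≤ #K)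
    (hK : ∀ x ∈ K, ∀ y ∈ K, x ≠ y → G.Adj x y) (h : HasSepCover G (S \ K) k) :
    HasSepCover G S (k + #S) := by
  have third : ∀ x y, ∃ z ∈ K, z ≠ x ∧ z ≠ y := by
    intro x y
    have h1 : #({x, y} : Finset V) ≤ 2 := card_le_two
    obtain ⟨z, hz, hz'⟩ := exists_mem_notMem_of_card_lt_card
      (show #({x, y} : Finset V) < #K by omega)
    exact ⟨z, hz, by simpa using hz'⟩
  refine (hasSepCover_of_clique hKS hK h (K.image fun x => K.erase x) ?_ ?_ ?_ ?_).mono ?_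
  · intro E hE
    obtain ⟨x, -, rfl⟩ := mem_image.1 hE
    exact erase_subset _ _
  · intro x hx y hy hxy
    obtain ⟨z, hz, hzx, hzy⟩ := third x y
    exact .inl ⟨K.erase z, mem_image_of_mem _ hz, by simp [hx, hzx.symm], by simp [hy, hzy.symm]⟩
  · intro x hx y hy hxy
    exact .inl ⟨K.erase y, mem_image_of_mem _ hy, by simp [hx, hxy], by simp⟩
  · intro x hx
    obtain ⟨z, hz, hzx, -⟩ := third x x
    exact .inl ⟨K.erase z, mem_image_of_mem _ hz, by simp [hx, hzx.symm]⟩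
  · have h1 : #(attached G (S \ K) K) ≤ #(S \ K) := card_le_card (attached_subset _ _ _)
    have h2 : #(K.image fun x => K.erase x) ≤ #K := card_image_le
    have h3 : #(S \ K) + #K = #S := card_sdiff_add_card_eq_card hKS
    omega

/-- The last clique `K` to be added may use the complementary sets: a vertex of `K` receives every
label except the private labels of its neighbours outside `K`, so that it contains the sets of its
non-neighbours. No label is then needed for the edges inside `K`. A vertex attached to `K` has a
private label, and is therefore exempt from the separation condition. The set `P` lists the vertices
of `K` that get a further private label. -/
theorem overlapNumber_le_of_last_clique [Fintype V] {K P : Finset V} {𝒞 : Finset (Finset V)}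
    (hK : ∀ x ∈ K, ∀ y ∈ K, x ≠ y → G.Adj x y) (hP : P ⊆ K)
    (hsub : ∀ C ∈ 𝒞, C ⊆ Kᶜ)
    (hclique : ∀ C ∈ 𝒞, ∀ x ∈ C, ∀ y ∈ C, x ≠ y → G.Adj x y)
    (hcover : ∀ x ∉ K, ∀ y ∉ K, G.Adj x y → ∃ C ∈ 𝒞, x ∈ C ∧ y ∈ C)
    (hsep : ∀ x ∉ K, ∀ y ∉ K, G.Adj x y → (∀ z ∈ K, ¬ G.Adj z x) → ∃ C ∈ 𝒞, x ∈ C ∧ y ∉ C)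
    (hmem : ∀ x ∉ K, ∃ C ∈ 𝒞, x ∈ C) (hne : 𝒞.Nonempty)
    (hout : ∀ x ∈ K, ∀ w ∉ K, G.Adj x w →
      (∃ C ∈ 𝒞, w ∉ C) ∨ ∃ w' ∈ attached G Kᶜ K, ¬ G.Adj x w')
    (hpriv : ∀ x ∈ K, ∀ y ∈ K, x ≠ y → x ∈ P ∨ ∃ w ∉ K, G.Adj y w ∧ ¬ G.Adj x w) :
    overlapNumber G ≤ #𝒞 + #(attached G Kᶜ K) + #P := by
  have hD : ∀ w, w ∉ K → ∀ x ∈ K, G.Adj x w → w ∈ attached G Kᶜ K := fun w hw x hx h =>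
    mem_attached.2 ⟨mem_compl.2 hw, x, hx, h⟩
  have hDK : ∀ w ∈ attached G Kᶜ K, w ∉ K := fun w hw => mem_compl.1 (mem_attached.1 hw).1
  have hCK : ∀ C ∈ 𝒞, ∀ x ∈ C, x ∉ K := fun C hC x hx => mem_compl.1 (hsub C hC hx)
  let M : V → Finset V ⊕ (V ⊕ V) → Prop := fun z a => match a with
    | .inl C => z ∈ K ∨ z ∈ C
    | .inr (.inl w) => if z ∈ K then ¬ G.Adj z w else z = w
    | .inr (.inr y) => z = y
  have key := overlapNumber_le_card (G := G) (𝒞.disjSum ((attached G Kᶜ K).disjSum P)) M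
    ?_ ?_ ?_
  · simpa [card_disjSum, add_assoc] using key
  · intro u v huv
    by_cases hu : u ∈ K <;> by_cases hv : v ∈ K
    · obtain ⟨C, hC⟩ := hne
      exact ⟨.inl C, by simp [hC], .inl hu, .inl hv⟩
    · obtain ⟨C, hC, h⟩ := hmem v hv
      exact ⟨.inl C, by simp [hC], .inl hu, .inr h⟩
    · obtain ⟨C, hC, h⟩ := hmem u hu
      exact ⟨.inl C, by simp [hC], .inr h, .inl hv⟩
    · obtain ⟨C, hC, h, h'⟩ := hcover u hu v hv huv
      exact ⟨.inl C, by simp [hC], .inr h, .inr h'⟩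
  · intro u v huv
    by_cases hu : u ∈ K <;> by_cases hv : v ∈ K
    · rcases hpriv u hu v hv huv.ne with h | ⟨w, hw, h1, h2⟩
      · exact ⟨.inr (.inr u), by simp [h], rfl, fun h => huv.ne h.symm⟩
      · exact ⟨.inr (.inl w), by simp [hD w hw v hv h1], by simp [M, hu, h2], by simp [M, hv, h1]⟩
    · rcases hout u hu v hv huv with ⟨C, hC, h⟩ | ⟨w, hw, h⟩
      · exact ⟨.inl C, by simp [hC], .inl hu, by simp [M, hv, h]⟩
      · refine ⟨.inr (.inl w), by simp [hw], by simp [M, hu, h], ?_⟩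
        have : v ≠ w := by
          rintro rfl
          exact h huv
        simp [M, hv, this]
    · exact ⟨.inr (.inl u), by simp [hD u hu v hv huv.symm], by simp [M, hu],
        by simp [M, hv, huv.symm]⟩
    · by_cases h : ∀ z ∈ K, ¬ G.Adj z u
      · obtain ⟨C, hC, h1, h2⟩ := hsep u hu v hv huv h
        exact ⟨.inl C, by simp [hC], .inr h1, by simp [M, hv, h2]⟩
      · push Not at h
        obtain ⟨z, hz, hzu⟩ := h
        exact ⟨.inr (.inl u), by simp [hD u hu z hz hzu], by simp [M, hu],
          by simp [M, hv, huv.ne']⟩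
  · have inK : ∀ u v, u ∈ K → v ∉ K → ¬ G.Adj u v →
        ∀ a ∈ 𝒞.disjSum ((attached G Kᶜ K).disjSum P), M v a → M u a := by
      intro u v hu hv huv a ha h
      rcases a with C | w | y
      · exact .inl hu
      · simp only [M, if_neg hv] at h
        subst h
        simpa [M, hu] using huv
      · have hy : y ∈ P := by simpa using ha
        have h' : v = y := h
        exact absurd (hP hy) (h' ▸ hv)
    intro u v huv hadj
    by_cases hu : u ∈ K <;> by_cases hv : v ∈ K
    · exact absurd (hK u hu v hv huv) hadj
    · exact .inr (.inr (inK u v hu hv hadj))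
    · exact .inr (.inl (inK v u hv hu fun h => hadj h.symm))
    · refine .inl fun a ha h1 h2 => ?_
      rcases a with C | w | y
      · have hC : C ∈ 𝒞 := by simpa using ha
        exact hadj (hclique C hC u (h1.resolve_left hu) v (h2.resolve_left hv) huv)
      · simp only [M, if_neg hu, if_neg hv] at h1 h2
        exact huv (h1.trans h2.symm)
      · exact huv (Eq.trans (b := y) h1 (Eq.symm h2))

/-- If the neighbourhood of `w` is contained in that of `u`, then `w` can be given a subset of the
labels of `u`, at the cost of one label. -/
theorem overlapNumber_le_of_dominated [Fintype V] {u w : V} {𝒞 : Finset (Finset V)} (huw : u ≠ w)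
    (hdom : ∀ x, G.Adj w x → G.Adj u x) (h𝒞 : IsSepCover G (univ.erase w) 𝒞)
    (htwo : ∀ C ∈ 𝒞, #C ≤ 2) : overlapNumber G ≤ #𝒞 + 1 := by
  have hmem : ∀ x, x ≠ w → x ∈ (univ.erase w : Finset V) := fun x hx => by simp [hx]
  have hw : ∀ C ∈ 𝒞, w ∉ C := fun C hC h => by simpa using h𝒞.subset C hC h
  have hadj : ¬ G.Adj w u := fun h => G.irrefl (hdom u h)
  let M : V → Option (Finset V) → Prop := fun z a => match a with
    | none => z = w ∨ z = u
    | some C => if z = w then u ∈ C ∧ ∃ x ∈ C, G.Adj w x else z ∈ C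
  have hMw : ∀ C, M w (some C) ↔ u ∈ C ∧ ∃ x ∈ C, G.Adj w x := fun C => by simp [M]
  have hM : ∀ z C, z ≠ w → (M z (some C) ↔ z ∈ C) := fun z C hz => by simp [M, hz]
  have key := overlapNumber_le_card (G := G) (insertNone 𝒞) M ?_ ?_ ?_
  · simpa using key
  · have meet : ∀ v, G.Adj w v → ∃ a ∈ insertNone 𝒞, M w a ∧ M v a := by
      intro v hv
      obtain ⟨C, hC, h1, h2⟩ := h𝒞.cover u (hmem u huw) v (hmem v hv.ne') (hdom v hv)
      exact ⟨some C, by simpa using hC, (hMw C).2 ⟨h1, v, h2, hv⟩, (hM v C hv.ne').2 h2⟩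
    intro a b hab
    by_cases ha : a = w
    · subst ha
      exact meet b hab
    by_cases hb : b = w
    · subst hb
      obtain ⟨c, hc, h1, h2⟩ := meet a hab.symm
      exact ⟨c, hc, h2, h1⟩
    obtain ⟨C, hC, h1, h2⟩ := h𝒞.cover a (hmem a ha) b (hmem b hb) hab
    exact ⟨some C, by simpa using hC, (hM a C ha).2 h1, (hM b C hb).2 h2⟩
  · intro a b hab
    by_cases ha : a = w
    · subst ha
      refine ⟨none, by simp, .inl rfl, ?_⟩
      rintro (rfl | rfl)
      · exact G.irrefl hab
      · exact hadj hab
    by_cases hb : b = w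
    · subst hb
      obtain ⟨C, hC, h1, h2⟩ := h𝒞.sep a (hmem a ha) u (hmem u huw) (hdom a hab.symm).symm
      exact ⟨some C, by simpa using hC, (hM a C ha).2 h1, fun h => h2 ((hMw C).1 h).1⟩
    obtain ⟨C, hC, h1, h2⟩ := h𝒞.sep a (hmem a ha) b (hmem b hb) hab
    exact ⟨some C, by simpa using hC, (hM a C ha).2 h1, fun h => h2 ((hM b C hb).1 h)⟩
  · have sub : ∀ a ∈ insertNone 𝒞, M w a → M u a := by
      intro a _ h
      cases a with
      | none => exact .inr rfl
      | some C => exact (hM u C huw).2 ((hMw C).1 h).1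
    have dis : ∀ v, v ≠ w → v ≠ u → ¬ G.Adj w v → ∀ a ∈ insertNone 𝒞, M w a → ¬ M v a := by
      intro v hvw hvu hv a ha h1 h2
      cases a with
      | none => exact h2.elim hvw hvu
      | some C =>
        obtain ⟨h3, x, hx, hwx⟩ := (hMw C).1 h1
        have h4 := (hM v C hvw).1 h2
        -- `C` would contain the three vertices `u`, `x`, `v`
        have hxu : x ≠ u := fun h => hadj (h ▸ hwx)
        have hxv : x ≠ v := fun h => hv (h ▸ hwx)
        have : #({u, x, v} : Finset V) ≤ #C := card_le_card (by
          intro y hy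
          simp only [mem_insert, mem_singleton] at hy
          rcases hy with rfl | rfl | rfl <;> assumption)
        rw [card_eq_three.2 ⟨u, x, v, hxu.symm, hvu.symm, hxv, rfl⟩] at this
        have := htwo C (by simpa using ha)
        omega
    intro a b hab hn
    by_cases ha : a = w
    · subst ha
      by_cases hb : b = u
      · exact hb ▸ .inr (.inl sub)
      · exact .inl (dis b hab.symm hb hn)
    by_cases hb : b = w
    · subst hb
      by_cases hau : a = u
      · exact hau ▸ .inr (.inr sub)
      · exact .inl fun c hc h1 h2 => dis a hab hau (fun h => hn h.symm) c hc h2 h1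
    refine .inl fun c hc h1 h2 => ?_
    cases c with
    | none => exact hab ((h1.resolve_left ha).trans (h2.resolve_left hb).symm)
    | some C => exact hn (h𝒞.clique C (by simpa using hc) a ((hM a C ha).1 h1) b
        ((hM b C hb).1 h2) hab)

/-! ### Counting edges inside a set of vertices -/

/-- The neighbours of `v` in `S`. -/
noncomputable def nbrs (G : SimpleGraph V) (S : Finset V) (v : V) : Finset V := {x ∈ S | G.Adj v x}

theorem mem_nbrs {S : Finset V} {v x : V} : x ∈ nbrs G S v ↔ x ∈ S ∧ G.Adj v x := mem_filter

/-- The edges with both ends in `S`, as sets of two vertices. -/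
noncomputable def edgesIn (G : SimpleGraph V) (S : Finset V) : Finset (Finset V) :=
  {e ∈ S.powersetCard 2 | ∀ x ∈ e, ∀ y ∈ e, x ≠ y → G.Adj x y}

theorem mem_edgesIn {S e : Finset V} :
    e ∈ edgesIn G S ↔ (e ⊆ S ∧ #e = 2) ∧ ∀ x ∈ e, ∀ y ∈ e, x ≠ y → G.Adj x y := by
  simp [edgesIn, mem_powersetCard]

theorem pair_mem_edgesIn {S : Finset V} {u v : V} (hu : u ∈ S) (hv : v ∈ S) (h : G.Adj u v) :
    {u, v} ∈ edgesIn G S := by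
  refine mem_edgesIn.2 ⟨⟨?_, card_pair h.ne⟩, ?_⟩
  · intro x hx
    simp only [mem_insert, mem_singleton] at hx
    rcases hx with rfl | rfl <;> assumption
  · intro x hx y hy hxy
    simp only [mem_insert, mem_singleton] at hx hy
    rcases hx with rfl | rfl <;> rcases hy with rfl | rfl
    · exact absurd rfl hxy
    · exact h
    · exact h.symm
    · exact absurd rfl hxy

theorem card_edgesIn_filter_mem {S : Finset V} {v : V} (hv : v ∈ S) :
    #{e ∈ edgesIn G S | v ∈ e} = #(nbrs G S v) := by
  have : {e ∈ edgesIn G S | v ∈ e} = (nbrs G S v).image fun w => {v, w} := by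
    ext e
    simp only [mem_filter, mem_image, mem_nbrs]
    constructor
    · rintro ⟨he, hve⟩
      obtain ⟨⟨hs, h2⟩, hc⟩ := mem_edgesIn.1 he
      obtain ⟨a, b, hab, rfl⟩ := card_eq_two.1 h2
      simp only [mem_insert, mem_singleton] at hve
      rcases hve with rfl | rfl
      · exact ⟨b, ⟨hs (by simp), hc _ (by simp) _ (by simp) hab⟩, rfl⟩
      · exact ⟨a, ⟨hs (by simp), hc _ (by simp) _ (by simp) hab.symm⟩, pair_comm _ _⟩
    · rintro ⟨w, ⟨hw, hvw⟩, rfl⟩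
      exact ⟨pair_mem_edgesIn hv hw hvw, by simp⟩
  rw [this, card_image_of_injOn]
  intro a ha b hb hab
  have ha' : v ≠ a := (mem_nbrs.1 (mem_coe.1 ha)).2.ne
  have : a ∈ ({v, b} : Finset V) := by
    rw [← show ({v, a} : Finset V) = {v, b} from hab]
    simp
  simpa [ha'.symm] using this

theorem sum_card_nbrs (G : SimpleGraph V) (S : Finset V) :
    ∑ v ∈ S, #(nbrs G S v) = 2 * #(edgesIn G S) := by
  calc ∑ v ∈ S, #(nbrs G S v) = ∑ v ∈ S, #{e ∈ edgesIn G S | v ∈ e} :=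
        sum_congr rfl fun v hv => (card_edgesIn_filter_mem hv).symm
    _ = ∑ e ∈ edgesIn G S, #{v ∈ S | v ∈ e} :=
        sum_card_bipartiteAbove_eq_sum_card_bipartiteBelow (fun v e => v ∈ e)
    _ = ∑ e ∈ edgesIn G S, 2 := by
        refine sum_congr rfl fun e he => ?_
        obtain ⟨⟨hs, h2⟩, -⟩ := mem_edgesIn.1 he
        rw [filter_mem_eq_inter, inter_eq_right.2 hs, h2]
    _ = 2 * #(edgesIn G S) := by rw [sum_const, smul_eq_mul, mul_comm]

theorem card_edgesIn_le_sdiff (G : SimpleGraph V) {S X : Finset V} (hX : X ⊆ S) :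
    #(edgesIn G S) ≤ #(edgesIn G (S \ X)) + ∑ v ∈ X, #(nbrs G S v) := by
  have h1 : edgesIn G S ⊆ edgesIn G (S \ X) ∪ X.biUnion fun v => {e ∈ edgesIn G S | v ∈ e} := by
    intro e he
    rw [mem_union, mem_biUnion]
    by_cases h : ∃ v ∈ X, v ∈ e
    · obtain ⟨v, hv, hve⟩ := h
      exact .inr ⟨v, hv, mem_filter.2 ⟨he, hve⟩⟩
    · push Not at h
      obtain ⟨⟨hs, h2⟩, hc⟩ := mem_edgesIn.1 he
      exact .inl (mem_edgesIn.2 ⟨⟨fun x hx => mem_sdiff.2 ⟨hs hx, fun hxX => h x hxX hx⟩, h2⟩, hc⟩)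
  calc #(edgesIn G S) ≤ _ := card_le_card h1
    _ ≤ _ := card_union_le _ _
    _ ≤ _ := by
      gcongr
      refine card_biUnion_le.trans_eq (sum_congr rfl fun v hv => card_edgesIn_filter_mem (hX hv))

theorem card_edgesIn_sdiff_pair {S : Finset V} {u v : V} (hu : u ∈ S) (hv : v ∈ S) (huv : u ≠ v) :
    #(edgesIn G (S \ {u, v})) + #(nbrs G S u) + #(nbrs G S v) ≤ #(edgesIn G S) + 1 := by
  rw [← card_edgesIn_filter_mem hu, ← card_edgesIn_filter_mem hv]
  set E := edgesIn G S
  have h1 := card_union_add_card_inter {e ∈ E | u ∈ e} {e ∈ E | v ∈ e}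
  have h2 : #({e ∈ E | u ∈ e} ∩ {e ∈ E | v ∈ e}) ≤ 1 := by
    refine card_le_one_iff_subset_singleton.2 ⟨{u, v}, fun e he => ?_⟩
    simp only [mem_inter, mem_filter] at he
    obtain ⟨⟨-, h2⟩, -⟩ := mem_edgesIn.1 he.1.1
    have : ({u, v} : Finset V) ⊆ e := by
      intro x hx
      simp only [mem_insert, mem_singleton] at hx
      rcases hx with rfl | rfl
      · exact he.1.2
      · exact he.2.2
    exact mem_singleton.2 (eq_of_subset_of_card_le this (by rw [h2, card_pair huv])).symm
  have h3 : Disjoint (edgesIn G (S \ {u, v})) ({e ∈ E | u ∈ e} ∪ {e ∈ E | v ∈ e}) := by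
    rw [disjoint_left]
    intro e he he'
    have hs := (mem_edgesIn.1 he).1.1
    simp only [mem_union, mem_filter] at he'
    rcases he' with h | h
    · simpa using hs h.2
    · simpa using hs h.2
  have h4 : edgesIn G (S \ {u, v}) ∪ ({e ∈ E | u ∈ e} ∪ {e ∈ E | v ∈ e}) ⊆ E := by
    refine union_subset (fun e he => ?_) (union_subset (filter_subset _ _) (filter_subset _ _))
    obtain ⟨⟨hs, h2⟩, hc⟩ := mem_edgesIn.1 he
    exact mem_edgesIn.2 ⟨⟨hs.trans sdiff_subset, h2⟩, hc⟩
  have h5 := card_le_card h4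
  rw [card_union_of_disjoint h3] at h5
  omega

/-- If the degrees in `S` of any two adjacent vertices add up to at most `M`, then `S` spans at most
`|S| M / 4` edges: sum over all edges and use the Cauchy–Schwarz inequality. -/
theorem four_mul_card_edgesIn_le {S : Finset V} {M : ℕ}
    (h : ∀ u ∈ S, ∀ v ∈ S, G.Adj u v → #(nbrs G S u) + #(nbrs G S v) ≤ M) :
    4 * #(edgesIn G S) ≤ #S * M := by
  have h1 : ∑ u ∈ S, ∑ v ∈ nbrs G S u, #(nbrs G S v) = ∑ u ∈ S, #(nbrs G S u) ^ 2 := by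
    rw [sum_comm' (t' := S) (s' := fun v => nbrs G S v)]
    · exact sum_congr rfl fun v _ => by rw [sum_const, smul_eq_mul, sq]
    · intro x y
      simp only [mem_nbrs, G.adj_comm y x]
      tauto
  have h2 : ∑ u ∈ S, ∑ v ∈ nbrs G S u, (#(nbrs G S u) + #(nbrs G S v))
      ≤ ∑ u ∈ S, #(nbrs G S u) * M := by
    refine sum_le_sum fun u hu => ?_
    calc _ ≤ ∑ v ∈ nbrs G S u, M :=
          sum_le_sum fun v hv => h u hu v (mem_nbrs.1 hv).1 (mem_nbrs.1 hv).2
      _ = _ := by rw [sum_const, smul_eq_mul]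
  have h3 : ∑ u ∈ S, ∑ v ∈ nbrs G S u, (#(nbrs G S u) + #(nbrs G S v))
      = 2 * ∑ u ∈ S, #(nbrs G S u) ^ 2 := by
    simp_rw [sum_add_distrib]
    rw [h1, two_mul]
    congr 1
    exact sum_congr rfl fun v _ => by rw [sum_const, smul_eq_mul, sq]
  have h4 := sq_sum_le_card_mul_sum_sq (s := S) (f := fun u => #(nbrs G S u))
  rw [h3, ← sum_mul, sum_card_nbrs] at h2
  rw [sum_card_nbrs] at h4
  rcases Nat.eq_zero_or_pos #(edgesIn G S) with h0 | hpos
  · simp [h0]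
  · refine Nat.le_of_mul_le_mul_right ?_ (show 0 < 2 * #(edgesIn G S) by omega)
    nlinarith

/-- No three vertices of `S` are pairwise adjacent. -/
def TriangleFreeOn (G : SimpleGraph V) (S : Finset V) : Prop :=
  ∀ x ∈ S, ∀ y ∈ S, ∀ z ∈ S, G.Adj x y → G.Adj x z → ¬ G.Adj y z

theorem TriangleFreeOn.mono {S T : Finset V} (h : TriangleFreeOn G S) (hT : T ⊆ S) :
    TriangleFreeOn G T :=
  fun x hx y hy z hz => h x (hT hx) y (hT hy) z (hT hz)

theorem TriangleFreeOn.disjoint_nbrs {S : Finset V} (h : TriangleFreeOn G S) {u v : V}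
    (hu : u ∈ S) (hv : v ∈ S) (huv : G.Adj u v) : Disjoint (nbrs G S u) (nbrs G S v) := by
  rw [disjoint_left]
  intro x hx hx'
  rw [mem_nbrs] at hx hx'
  exact h u hu v hv x hx.1 huv hx.2 hx'.2

theorem TriangleFreeOn.card_nbrs_add_le {S : Finset V} (h : TriangleFreeOn G S) {u v : V}
    (hu : u ∈ S) (hv : v ∈ S) (huv : G.Adj u v) : #(nbrs G S u) + #(nbrs G S v) ≤ #S := by
  rw [← card_union_of_disjoint (h.disjoint_nbrs hu hv huv)]
  exact card_le_card (union_subset (filter_subset _ _) (filter_subset _ _))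

/-- Mantel's theorem. -/
theorem TriangleFreeOn.four_mul_card_edgesIn_le {S : Finset V} (h : TriangleFreeOn G S) :
    4 * #(edgesIn G S) ≤ #S * #S :=
  OverlapBound.four_mul_card_edgesIn_le fun _ hu _ hv huv => h.card_nbrs_add_le hu hv huv

/-- The vertices of degree at most one in `S`. -/
noncomputable def leavesIn (G : SimpleGraph V) (S : Finset V) : Finset V :=
  {v ∈ S | #(nbrs G S v) ≤ 1}

theorem TriangleFreeOn.four_mul_card_edgesIn_le_leaves {S : Finset V} (h : TriangleFreeOn G S) :
    4 * #(edgesIn G S) ≤ (#S - #(leavesIn G S)) ^ 2 + 4 * #(leavesIn G S) := by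
  have hs : leavesIn G S ⊆ S := filter_subset _ _
  have h1 := card_edgesIn_le_sdiff G hs
  have h2 : ∑ v ∈ leavesIn G S, #(nbrs G S v) ≤ ∑ v ∈ leavesIn G S, 1 :=
    sum_le_sum fun v hv => (mem_filter.1 hv).2
  have h3 := (h.mono (sdiff_subset (s := S) (t := leavesIn G S))).four_mul_card_edgesIn_le
  rw [card_sdiff_of_subset hs, ← sq] at h3
  simp only [sum_const, smul_eq_mul, mul_one] at h2
  omega

/-- A triangle-free set that spans almost as many edges as possible contains a large set of vertices
with a common neighbourhood: it is bipartite with few edges missing, and `A` consists of those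
vertices in the larger class that have no missing edge. -/
theorem TriangleFreeOn.exists_common_nbrs {S : Finset V} (h : TriangleFreeOn G S)
    (he : #S * (#S - 1) < 4 * #(edgesIn G S)) :
    ∃ A ⊆ S, (∀ a ∈ A, ∀ b ∈ A, ∀ x ∈ S, G.Adj a x ↔ G.Adj b x) ∧
      #S + 2 * #(edgesIn G S) ≤ 2 * #A + 2 * (#S ^ 2 / 4) := by
  have hedge : ∃ u ∈ S, ∃ v ∈ S, G.Adj u v ∧ #S ≤ #(nbrs G S u) + #(nbrs G S v) ∧
      #(nbrs G S u) ≤ #(nbrs G S v) := by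
    by_contra hcon
    push Not at hcon
    refine he.not_ge (OverlapBound.four_mul_card_edgesIn_le fun u hu v hv huv => ?_)
    rcases le_total #(nbrs G S u) #(nbrs G S v) with hle | hle
    · by_contra hlt
      exact (hcon u hu v hv huv (by omega)).not_ge hle
    · by_contra hlt
      exact (hcon v hv u hu huv.symm (by omega)).not_ge hle
  obtain ⟨u, hu, v, hv, huv, hsum, hle⟩ := hedge
  set X := nbrs G S v with hX
  set Y := nbrs G S u with hY
  have hXS : X ⊆ S := filter_subset _ _
  have hYS : Y ⊆ S := filter_subset _ _
  have hunion : Y ∪ X = S := by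
    refine eq_of_subset_of_card_le (union_subset hYS hXS) ?_
    rw [card_union_of_disjoint (h.disjoint_nbrs hu hv huv)]
    exact hsum
  have hsum' : #Y + #X = #S := by
    rw [← hunion, card_union_of_disjoint (h.disjoint_nbrs hu hv huv)]
  have hXY : ∀ a ∈ X, nbrs G S a ⊆ Y := by
    intro a ha x hx
    rw [mem_nbrs] at hx
    have hx' : x ∈ Y ∪ X := hunion ▸ hx.1
    refine (mem_union.1 hx').resolve_right fun hxX => ?_
    exact h v hv a (hXS ha) x hx.1 (mem_nbrs.1 ha).2 (mem_nbrs.1 hxX).2 hx.2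
  have hY0 : #(edgesIn G (S \ X)) = 0 := by
    rw [card_eq_zero, eq_empty_iff_forall_notMem]
    intro e he
    obtain ⟨⟨hs, h2⟩, hc⟩ := mem_edgesIn.1 he
    obtain ⟨a, b, hab, rfl⟩ := card_eq_two.1 h2
    have hin : ∀ x ∈ ({a, b} : Finset V), x ∈ Y := fun x hx => by
      obtain ⟨h3, h4⟩ := mem_sdiff.1 (hs hx)
      exact (mem_union.1 (hunion ▸ h3 : x ∈ Y ∪ X)).resolve_right h4
    have ha := mem_nbrs.1 (hin a (by simp))
    have hb := mem_nbrs.1 (hin b (by simp))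
    exact h u hu a ha.1 b hb.1 ha.2 hb.2 (hc a (by simp) b (by simp) hab)
  refine ⟨{a ∈ X | nbrs G S a = Y}, (filter_subset _ _).trans hXS, ?_, ?_⟩
  · intro a ha b hb x hx
    have : nbrs G S a = nbrs G S b := (mem_filter.1 ha).2.trans (mem_filter.1 hb).2.symm
    have h1 : x ∈ nbrs G S a ↔ x ∈ nbrs G S b := by rw [this]
    simpa [mem_nbrs, hx] using h1
  · have h1 := card_edgesIn_le_sdiff G hXS
    have h2 : ∑ a ∈ X, #(nbrs G S a) + #{a ∈ X | ¬ nbrs G S a = Y} ≤ #X * #Y := by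
      rw [card_filter, ← sum_add_distrib, ← smul_eq_mul, ← sum_const]
      refine sum_le_sum fun a ha => ?_
      split_ifs with hc
      · exact card_le_card (hXY a ha)
      · exact card_lt_card ((hXY a ha).ssubset_of_ne hc)
    have h3 := card_filter_add_card_filter_not (s := X) (fun a => nbrs G S a = Y)
    have h4 : #X * #Y ≤ #S ^ 2 / 4 := by
      rw [Nat.le_div_iff_mul_le (by norm_num), ← hsum']
      zify
      nlinarith [sq_nonneg ((#X : ℤ) - #Y)]
    omega

/-! ### Small separating clique covers -/

/-- All edges inside `S`, and the vertices of degree at most one in `S` as singletons. -/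
noncomputable def edgeCover (G : SimpleGraph V) (S : Finset V) : Finset (Finset V) :=
  edgesIn G S ∪ (leavesIn G S).image fun v => {v}

theorem isSepCover_edgeCover (G : SimpleGraph V) (S : Finset V) :
    IsSepCover G S (edgeCover G S) := by
  have hedge : ∀ x ∈ S, ∀ y ∈ S, G.Adj x y → {x, y} ∈ edgeCover G S := fun x hx y hy hxy =>
    mem_union_left _ (pair_mem_edgesIn hx hy hxy)
  have hleaf : ∀ x ∈ leavesIn G S, {x} ∈ edgeCover G S := fun x hx =>
    mem_union_right _ (mem_image_of_mem _ hx)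
  refine ⟨?_, ?_, ?_, ?_, ?_⟩
  · intro C hC
    rcases mem_union.1 hC with hC | hC
    · exact (mem_edgesIn.1 hC).1.1
    · obtain ⟨v, hv, rfl⟩ := mem_image.1 hC
      exact singleton_subset_iff.2 (mem_filter.1 hv).1
  · intro C hC x hx y hy hxy
    rcases mem_union.1 hC with hC | hC
    · exact (mem_edgesIn.1 hC).2 x hx y hy hxy
    · obtain ⟨v, -, rfl⟩ := mem_image.1 hC
      rw [mem_singleton] at hx hy
      exact absurd (hx.trans hy.symm) hxy
  · exact fun x hx y hy hxy => ⟨_, hedge x hx y hy hxy, by simp, by simp⟩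
  · intro x hx y hy hxy
    by_cases hl : #(nbrs G S x) ≤ 1
    · exact ⟨_, hleaf x (mem_filter.2 ⟨hx, hl⟩), by simp, by simpa using hxy.ne'⟩
    · obtain ⟨z, hz, hzy⟩ := exists_mem_ne (not_le.1 hl) y
      rw [mem_nbrs] at hz
      exact ⟨_, hedge x hx z hz.1 hz.2, by simp, by simp [hxy.ne', hzy.symm]⟩
  · intro x hx
    by_cases hl : #(nbrs G S x) ≤ 1
    · exact ⟨_, hleaf x (mem_filter.2 ⟨hx, hl⟩), by simp⟩
    · obtain ⟨z, hz⟩ := card_pos.1 (lt_trans one_pos (not_le.1 hl))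
      rw [mem_nbrs] at hz
      exact ⟨_, hedge x hx z hz.1 hz.2, by simp⟩

theorem card_edgeCover_le (G : SimpleGraph V) (S : Finset V) :
    #(edgeCover G S) ≤ #(edgesIn G S) + #(leavesIn G S) :=
  (card_union_le _ _).trans (Nat.add_le_add_left card_image_le _)

theorem card_le_two_of_mem_edgeCover {S C : Finset V} (hC : C ∈ edgeCover G S) : #C ≤ 2 := by
  rcases mem_union.1 hC with hC | hC
  · exact (mem_edgesIn.1 hC).1.2.le
  · obtain ⟨v, -, rfl⟩ := mem_image.1 hC
    simp

theorem attached_singleton {S : Finset V} {v : V} :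
    attached G (S \ {v}) {v} = nbrs G S v := by
  ext w
  simp only [mem_attached, mem_nbrs, mem_sdiff, mem_singleton, exists_eq_left]
  exact ⟨fun h => ⟨h.1.1, h.2⟩, fun h => ⟨⟨h.1, h.2.ne'⟩, h.2⟩⟩

theorem hasSepCover_of_vertex {S : Finset V} {v : V} {k : ℕ} (hv : v ∈ S)
    (h : HasSepCover G (S \ {v}) k) : HasSepCover G S (k + #(nbrs G S v) + 1) := by
  have := hasSepCover_of_clique (singleton_subset_iff.2 hv) (by simp) h {{v}} (by simp) (by simp)
    (by simp) (by simp)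
  rwa [attached_singleton] at this

theorem hasSepCover_of_vertex_of_two_le {S : Finset V} {v : V} {k : ℕ} (hv : v ∈ S)
    (hd : 2 ≤ #(nbrs G S v)) (h : HasSepCover G (S \ {v}) k) :
    HasSepCover G S (k + #(nbrs G S v)) := by
  have := hasSepCover_of_clique (singleton_subset_iff.2 hv) (by simp) h ∅ (by simp) (by simp)
    (by simp) ?_
  · rwa [attached_singleton] at this
  · intro x hx
    rw [mem_singleton] at hx
    subst hx
    obtain ⟨a, ha, b, hb, hab⟩ := one_lt_card.1 hd
    rw [mem_nbrs] at ha hb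
    exact .inr ⟨a, by simp [ha.1, ha.2.ne'], b, by simp [hb.1, hb.2.ne'], hab, ha.2, hb.2⟩

/-- Adding an edge with a common neighbour; `P` contains each end without a neighbour of its own. -/
theorem hasSepCover_of_edge {S P : Finset V} {u v z : V} {k : ℕ} (hu : u ∈ S) (hv : v ∈ S)
    (huv : G.Adj u v) (hz : z ∈ S) (hzu : G.Adj u z) (hzv : G.Adj v z) (hP : P ⊆ {u, v})
    (hpu : u ∈ P ∨ ∃ w ∈ S \ {u, v}, G.Adj u w ∧ ¬ G.Adj v w)
    (hpv : v ∈ P ∨ ∃ w ∈ S \ {u, v}, G.Adj v w ∧ ¬ G.Adj u w)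
    (h : HasSepCover G (S \ {u, v}) k) :
    HasSepCover G S (k + #(attached G (S \ {u, v}) {u, v}) + #P) := by
  have hz' : z ∈ S \ {u, v} := by simp [hz, hzu.ne', hzv.ne']
  have hcl : ∀ x ∈ ({u, v} : Finset V), ∀ y ∈ ({u, v} : Finset V), x ≠ y →
      x = u ∧ y = v ∨ x = v ∧ y = u := by
    intro x hx y hy hxy
    simp only [mem_insert, mem_singleton] at hx hy
    rcases hx with rfl | rfl <;> rcases hy with rfl | rfl <;> simp_all
  refine (hasSepCover_of_clique ?_ ?_ h (P.image fun x => {x}) ?_ ?_ ?_ ?_).mono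
    (Nat.add_le_add_left card_image_le _)
  · simp [insert_subset_iff, hu, hv]
  · intro x hx y hy hxy
    rcases hcl x hx y hy hxy with ⟨rfl, rfl⟩ | ⟨rfl, rfl⟩
    · exact huv
    · exact huv.symm
  · intro E hE
    obtain ⟨x, hx, rfl⟩ := mem_image.1 hE
    exact singleton_subset_iff.2 (hP hx)
  · intro x hx y hy hxy
    rcases hcl x hx y hy hxy with ⟨rfl, rfl⟩ | ⟨rfl, rfl⟩
    · exact .inr ⟨z, hz', hzu, hzv⟩
    · exact .inr ⟨z, hz', hzv, hzu⟩
  · intro x hx y hy hxy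
    rcases hcl x hx y hy hxy with ⟨rfl, rfl⟩ | ⟨rfl, rfl⟩
    · exact hpu.imp (fun h => ⟨{x}, mem_image_of_mem _ h, by simp, by simpa using hxy.symm⟩) id
    · exact hpv.imp (fun h => ⟨{x}, mem_image_of_mem _ h, by simp, by simpa using hxy.symm⟩) id
  · intro x hx
    simp only [mem_insert, mem_singleton] at hx
    rcases hx with rfl | rfl
    · refine hpu.imp (fun h => ⟨{x}, mem_image_of_mem _ h, by simp⟩) ?_
      rintro ⟨w, hw, h1, h2⟩
      exact ⟨w, hw, z, hz', fun h => h2 (h ▸ hzv), h1, hzu⟩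
    · refine hpv.imp (fun h => ⟨{x}, mem_image_of_mem _ h, by simp⟩) ?_
      rintro ⟨w, hw, h1, h2⟩
      exact ⟨w, hw, z, hz', fun h => h2 (h ▸ hzu), h1, hzv⟩

theorem even_sq_div_four (k : ℕ) : (2 * k) ^ 2 / 4 = k * k := by
  rw [show (2 * k) ^ 2 = 4 * (k * k) by ring]
  omega

theorem odd_sq_div_four (k : ℕ) : (2 * k + 1) ^ 2 / 4 = k * k + k := by
  rw [show (2 * k + 1) ^ 2 = 4 * (k * k + k) + 1 by ring]
  omega

/-- A bound for the size of a separating clique cover of any graph with `n` vertices. -/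
def coverBound (n : ℕ) : ℕ := if n ≤ 1 then n else n ^ 2 / 4 + 2

theorem coverBound_of_two_le {n : ℕ} (h : 2 ≤ n) : coverBound n = n ^ 2 / 4 + 2 := by
  rw [coverBound, if_neg (by omega)]

theorem sq_div_four_succ (n : ℕ) : (n + 1) ^ 2 / 4 = n ^ 2 / 4 + (n + 1) / 2 := by
  obtain ⟨k, rfl | rfl⟩ := Nat.even_or_odd' n
  · rw [odd_sq_div_four, even_sq_div_four]
    omega
  · rw [show 2 * k + 1 + 1 = 2 * (k + 1) by ring, odd_sq_div_four, even_sq_div_four,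
      show (k + 1) * (k + 1) = k * k + 2 * k + 1 by ring]
    omega

theorem coverBound_succ {n : ℕ} (h : 2 ≤ n) :
    coverBound (n + 1) = coverBound n + (n + 1) / 2 := by
  rw [coverBound_of_two_le h, coverBound_of_two_le (by omega), sq_div_four_succ]
  omega

theorem le_coverBound (n : ℕ) : n ≤ coverBound n := by
  obtain h | h := Nat.lt_or_ge n 4
  · interval_cases n <;> simp [coverBound]
  · rw [coverBound_of_two_le (by omega), ← Nat.sub_le_iff_le_add, Nat.le_div_iff_mul_le (by norm_num)]
    obtain ⟨k, rfl⟩ := Nat.exists_eq_add_of_le h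
    rw [show 4 + k - 2 = k + 2 by omega]
    nlinarith

/-- Every graph has a separating clique cover with about `n ^ 2 / 4` members. A vertex of degree at
most `n / 2` may be removed; if there is none, every edge lies in a triangle, and unless the graph
is complete the two ends of an edge at a vertex with a non-neighbour may be removed. -/
theorem hasSepCover_coverBound (G : SimpleGraph V) (S : Finset V) :
    HasSepCover G S (coverBound #S) := by
  induction hn : #S using Nat.strong_induction_on generalizing S with
  | _ n ih =>
  have ih' : ∀ T ⊂ S, HasSepCover G T (coverBound #T) := fun T hT =>
    ih _ (hn ▸ card_lt_card hT) T rfl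
  rcases S.eq_empty_or_nonempty with rfl | hne
  · exact hasSepCover_empty.mono (Nat.zero_le _)
  have hn0 : 0 < n := hn ▸ card_pos.2 hne
  obtain ⟨v, hv, hmin⟩ := exists_min_image S (fun v => #(nbrs G S v)) hne
  have herase : ∀ x ∈ S, HasSepCover G (S \ {x}) (coverBound (n - 1)) := by
    intro x hx
    have := ih' (S \ {x}) (sdiff_ssubset (by simpa using hx) (by simp))
    rwa [card_sdiff_of_subset (by simpa using hx), hn, card_singleton] at this
  have hpair : ∀ x ∈ S, ∀ y ∈ S, x ≠ y → #(S \ {x, y}) = n - 2 ∧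
      HasSepCover G (S \ {x, y}) (coverBound (n - 2)) := by
    intro x hx y hy hxy
    have hs : ({x, y} : Finset V) ⊆ S := by simp [insert_subset_iff, hx, hy]
    have h1 : #(S \ {x, y}) = n - 2 := by rw [card_sdiff_of_subset hs, hn, card_pair hxy]
    exact ⟨h1, h1 ▸ ih' _ (sdiff_ssubset hs (by simp))⟩
  by_cases hlow : 2 * #(nbrs G S v) ≤ n
  · by_cases hd : 2 ≤ #(nbrs G S v)
    · refine (hasSepCover_of_vertex_of_two_le hv hd (herase v hv)).mono ?_
      obtain ⟨m, rfl⟩ : ∃ m, n = m + 1 := ⟨n - 1, by omega⟩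
      rw [coverBound_succ (by omega), Nat.add_sub_cancel]
      omega
    by_cases h3 : n = 3 ∧ #(nbrs G S v) = 1
    · -- a path on three vertices, with end `v` and centre `x`
      obtain ⟨rfl, h1⟩ := h3
      obtain ⟨x, hx⟩ := card_eq_one.1 h1
      have hx' : x ∈ S ∧ G.Adj v x := mem_nbrs.1 (hx ▸ mem_singleton_self x)
      obtain ⟨hc, hcov⟩ := hpair v hv x hx'.1 hx'.2.ne
      obtain ⟨y, hy⟩ := card_eq_one.1 hc
      have hyS : y ∈ S \ {v, x} := hy ▸ mem_singleton_self y
      have hyS' : y ∈ S ∧ y ≠ v ∧ y ≠ x := by simpa using hyS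
      have hxy : G.Adj x y := by
        have := hmin y hyS'.1
        rw [h1] at this
        obtain ⟨z, hz⟩ := card_pos.1 this
        rw [mem_nbrs] at hz
        have hzvx : z = v ∨ z = x := by
          by_contra hcon
          push Not at hcon
          have : z ∈ S \ {v, x} := by simp [hz.1, hcon]
          rw [hy, mem_singleton] at this
          exact hz.2.ne this.symm
        rcases hzvx with rfl | rfl
        · have : y ∈ nbrs G S z := mem_nbrs.2 ⟨hyS'.1, hz.2.symm⟩
          rw [hx, mem_singleton] at this
          exact absurd this hyS'.2.2
        · exact hz.2.symm
      have hvy : ¬ G.Adj v y := fun h => by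
        have : y ∈ nbrs G S v := mem_nbrs.2 ⟨hyS'.1, h⟩
        rw [hx, mem_singleton] at this
        exact hyS'.2.2 this
      refine (hasSepCover_of_clique (K := {v, x}) ?_ ?_ hcov {{v, x}, {v}} ?_ ?_ ?_ ?_).mono ?_
      · simp [insert_subset_iff, hv, hx'.1]
      · intro a ha b hb hab
        simp only [mem_insert, mem_singleton] at ha hb
        rcases ha with rfl | rfl <;> rcases hb with rfl | rfl
        · exact absurd rfl hab
        · exact hx'.2
        · exact hx'.2.symm
        · exact absurd rfl hab
      · simp
      · exact fun a ha b hb _ => .inl ⟨{v, x}, by simp, ha, hb⟩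
      · intro a ha b hb hab
        simp only [mem_insert, mem_singleton] at ha hb
        rcases ha with rfl | rfl <;> rcases hb with rfl | rfl
        · exact absurd rfl hab
        · exact .inl ⟨{a}, by simp, by simp, by simpa using hab.symm⟩
        · exact .inr ⟨y, hyS, hxy, hvy⟩
        · exact absurd rfl hab
      · exact fun a ha => .inl ⟨{v, x}, by simp, ha⟩
      · have h2 : #(attached G (S \ {v, x}) {v, x}) ≤ 1 :=
          (card_le_card (attached_subset _ _ _)).trans hc.le
        have h4 : #({{v, x}, {v}} : Finset (Finset V)) ≤ 2 := card_le_two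
        have h5 : coverBound (3 - 2) = 1 := by simp [coverBound]
        have h6 : coverBound 3 = 4 := by simp [coverBound]
        omega
    refine (hasSepCover_of_vertex hv (herase v hv)).mono ?_
    obtain h | h := Nat.lt_or_ge n 4
    · have h0 : coverBound 0 = 0 := by simp [coverBound]
      have h1 : coverBound 1 = 1 := by simp [coverBound]
      have h2 : coverBound 2 = 3 := by simp [coverBound]
      have h3 : coverBound 3 = 4 := by simp [coverBound]
      interval_cases n <;> simp only [Nat.reduceSub] <;> omega
    · obtain ⟨m, rfl⟩ : ∃ m, n = m + 1 := ⟨n - 1, by omega⟩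
      rw [coverBound_succ (by omega), Nat.add_sub_cancel]
      omega
  have hdeg : ∀ x ∈ S, n < 2 * #(nbrs G S x) := fun x hx => by
    have := hmin x hx
    omega
  have hdegle : ∀ x ∈ S, #(nbrs G S x) + 1 ≤ n := fun x hx => by
    have : nbrs G S x ⊆ S.erase x := fun y hy =>
      mem_erase.2 ⟨(mem_nbrs.1 hy).2.ne', (mem_nbrs.1 hy).1⟩
    have := card_le_card this
    rw [card_erase_of_mem hx, hn] at this
    omega
  have hn3 : 3 ≤ n := by
    have := hdeg v hv
    have := hdegle v hv
    omega
  by_cases hcl : ∀ x ∈ S, ∀ y ∈ S, x ≠ y → G.Adj x y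
  · have h0 : HasSepCover G (S \ S) 0 := by
      rw [sdiff_self]
      exact hasSepCover_empty
    refine (hasSepCover_of_three_le_card Subset.rfl (hn ▸ hn3) hcl h0).mono ?_
    rw [hn, zero_add]
    exact le_coverBound n
  push Not at hcl
  obtain ⟨u, hu, z, hz, huz, hnuz⟩ := hcl
  obtain ⟨v, hv⟩ := card_pos.1 (show 0 < #(nbrs G S u) by have := hdeg u hu; omega)
  obtain ⟨hv, huv⟩ := mem_nbrs.1 hv
  obtain ⟨y, hy⟩ : (nbrs G S u ∩ nbrs G S v).Nonempty := by
    rw [← card_pos]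
    have h1 := card_union_add_card_inter (nbrs G S u) (nbrs G S v)
    have h2 : #(nbrs G S u ∪ nbrs G S v) ≤ n :=
      hn ▸ card_le_card (union_subset (filter_subset _ _) (filter_subset _ _))
    have := hdeg u hu
    have := hdeg v hv
    omega
  rw [mem_inter, mem_nbrs, mem_nbrs] at hy
  obtain ⟨hc, hcov⟩ := hpair u hu v hv huv.ne
  have hzv : z ≠ v := by
    rintro rfl
    exact hnuz huv
  have hzS : z ∈ S \ {u, v} := by simp [hz, huz.symm, hzv]
  have hatt : #(attached G (S \ {u, v}) {u, v}) ≤ n - 2 :=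
    hc ▸ card_le_card (attached_subset _ _ _)
  have hbound : coverBound (n - 2) + (n - 1) ≤ coverBound n := by
    obtain rfl | h4 : n = 3 ∨ 4 ≤ n := by omega
    · simp [coverBound]
    · obtain ⟨m, rfl⟩ : ∃ m, n = m + 2 := ⟨n - 2, by omega⟩
      have h5 := coverBound_succ (n := m + 1) (by omega)
      have h6 := coverBound_succ (n := m) (by omega)
      rw [Nat.add_sub_cancel]
      rw [show m + 1 + 1 = m + 2 by ring] at h5
      omega
  have fin : ∀ P : Finset V, P ⊆ {u, v} →
      #(attached G (S \ {u, v}) {u, v}) + #P ≤ n - 1 →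
      (u ∈ P ∨ ∃ w ∈ S \ {u, v}, G.Adj u w ∧ ¬ G.Adj v w) →
      (v ∈ P ∨ ∃ w ∈ S \ {u, v}, G.Adj v w ∧ ¬ G.Adj u w) → HasSepCover G S (coverBound n) :=
    fun P hP hcard hpu hpv => (hasSepCover_of_edge hu hv huv hy.1.1 hy.1.2 hy.2.2 hP hpu hpv
      hcov).mono (by omega)
  by_cases hpu : ∃ w ∈ S \ {u, v}, G.Adj u w ∧ ¬ G.Adj v w
  · exact fin {v} (by simp) (by rw [card_singleton]; omega) (.inr hpu) (.inl (by simp))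
  by_cases hpv : ∃ w ∈ S \ {u, v}, G.Adj v w ∧ ¬ G.Adj u w
  · exact fin {u} (by simp) (by rw [card_singleton]; omega) (.inl (by simp)) (.inr hpv)
  -- `u` and `v` have the same neighbours, so that `z` is attached to neither
  refine fin {u, v} Subset.rfl ?_ (.inl (by simp)) (.inl (by simp))
  have hsub : attached G (S \ {u, v}) {u, v} ⊆ (S \ {u, v}).erase z := by
    intro w hw
    refine mem_erase.2 ⟨?_, attached_subset _ _ _ hw⟩
    rintro rfl
    obtain ⟨-, x, hx, hxw⟩ := mem_attached.1 hw
    simp only [mem_insert, mem_singleton] at hx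
    rcases hx with rfl | rfl
    · exact hnuz hxw
    · push Not at hpv
      exact hnuz (hpv w hzS hxw)
  have h1 := card_le_card hsub
  rw [card_erase_of_mem hzS, hc] at h1
  have h2 : #({u, v} : Finset V) ≤ 2 := card_le_two
  omega

theorem TriangleFreeOn.card_edgesIn_add_card_leavesIn_le {S : Finset V} (h : TriangleFreeOn G S)
    (h8 : 8 ≤ #S) : #(edgesIn G S) + #(leavesIn G S) ≤ #S ^ 2 / 4 := by
  have h1 := h.four_mul_card_edgesIn_le_leaves
  have h2 : #(leavesIn G S) ≤ #S := card_le_card (filter_subset _ _)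
  rw [Nat.le_div_iff_mul_le (by norm_num)]
  generalize #(leavesIn G S) = l at *
  generalize #(edgesIn G S) = e at *
  generalize #S = s at *
  obtain ⟨r, rfl⟩ := Nat.exists_eq_add_of_le h2
  rw [Nat.add_sub_cancel_left] at h1
  nlinarith [Nat.zero_le (l * (l + 2 * r - 8)), mul_le_mul_right (α := ℕ) (show 8 ≤ l + r by omega) l,
    Nat.zero_le (l * r)]

/-- A vertex of degree at most one makes a triangle-free graph far from extremal. -/
theorem TriangleFreeOn.card_edgesIn_add_card_leavesIn_le_of_leaf {S : Finset V}
    (h : TriangleFreeOn G S) (h9 : 9 ≤ #S) (hl : 1 ≤ #(leavesIn G S)) :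
    #(edgesIn G S) + #(leavesIn G S) ≤ (#S - 1) ^ 2 / 4 + 2 := by
  have h1 := h.four_mul_card_edgesIn_le_leaves
  have h2 : #(leavesIn G S) ≤ #S := card_le_card (filter_subset _ _)
  rw [← Nat.sub_le_iff_le_add, Nat.le_div_iff_mul_le (by norm_num)]
  generalize #(leavesIn G S) = l at *
  generalize #(edgesIn G S) = e at *
  generalize #S = s at *
  obtain ⟨r, rfl⟩ := Nat.exists_eq_add_of_le h2
  obtain ⟨m, rfl⟩ := Nat.exists_eq_add_of_le hl
  rw [Nat.add_sub_cancel_left] at h1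
  rw [show 1 + m + r - 1 = m + r by omega]
  suffices 4 * (e + (1 + m)) ≤ (m + r) ^ 2 + 8 by omega
  nlinarith [mul_le_mul_right (α := ℕ) (show 8 ≤ m + r by omega) m, Nat.zero_le (m * r)]

theorem adj_of_mem_triple {x y z : V} (hxy : G.Adj x y) (hxz : G.Adj x z) (hyz : G.Adj y z) :
    ∀ a ∈ ({x, y, z} : Finset V), ∀ b ∈ ({x, y, z} : Finset V), a ≠ b → G.Adj a b := by
  intro a ha b hb hab
  simp only [mem_insert, mem_singleton] at ha hb
  rcases ha with rfl | rfl | rfl <;> rcases hb with rfl | rfl | rfl <;>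
    first | exact absurd rfl hab | assumption | (apply SimpleGraph.Adj.symm; assumption)

/-- From eight vertices on, `n ^ 2 / 4` members suffice for a separating clique cover. -/
theorem hasSepCover_sq_div_four (G : SimpleGraph V) {S : Finset V} (h8 : 8 ≤ #S) :
    HasSepCover G S (#S ^ 2 / 4) := by
  by_cases h : TriangleFreeOn G S
  · exact ⟨edgeCover G S, isSepCover_edgeCover G S,
      (card_edgeCover_le G S).trans (h.card_edgesIn_add_card_leavesIn_le h8)⟩
  · simp only [TriangleFreeOn] at h
    push Not at h
    obtain ⟨x, hx, y, hy, z, hz, hxy, hxz, hyz⟩ := h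
    have h3 : #({x, y, z} : Finset V) = 3 := card_eq_three.2 ⟨x, y, z, hxy.ne, hxz.ne, hyz.ne, rfl⟩
    have hs : ({x, y, z} : Finset V) ⊆ S := by simp [insert_subset_iff, hx, hy, hz]
    refine (hasSepCover_of_three_le_card hs h3.ge (adj_of_mem_triple hxy hxz hyz)
      (hasSepCover_coverBound G _)).mono ?_
    rw [card_sdiff_of_subset hs, h3, coverBound_of_two_le (by omega)]
    obtain ⟨m, hm⟩ := Nat.exists_eq_add_of_le' h8
    rw [hm, show m + 8 - 3 = m + 5 by omega]
    have h1 := sq_div_four_succ (m + 5)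
    have h2 := sq_div_four_succ (m + 6)
    have h3 := sq_div_four_succ (m + 7)
    simp only [add_assoc, Nat.reduceAdd] at h1 h2 h3
    omega

/-! ### Triangle-free graphs -/

theorem IsSepCover.exists_notMem {S : Finset V} {𝒞 : Finset (Finset V)} (h : IsSepCover G S 𝒞)
    {x y : V} (hx : x ∈ S) (hy : y ∈ S) (hxy : x ≠ y) : ∃ C ∈ 𝒞, x ∈ C ∧ y ∉ C := by
  by_cases hadj : G.Adj x y
  · exact h.sep x hx y hy hadj
  · obtain ⟨C, hC, hxC⟩ := h.mem x hx
    exact ⟨C, hC, hxC, fun hyC => hadj (h.clique C hC x hxC y hyC hxy)⟩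

theorem le_max_of_le_sq_div_four_add_three {n k : ℕ} (h12 : 12 ≤ n) (h : k ≤ (n - 2) ^ 2 / 4 + 3) :
    k ≤ max 41 (n * (n - 2) / 4 - 1) := by
  obtain ⟨m, rfl⟩ := Nat.exists_eq_add_of_le' h12
  rw [show m + 12 - 2 = m + 10 by omega] at *
  rcases Nat.lt_or_ge m 2 with hm | hm
  · refine le_max_of_le_left (h.trans ?_)
    interval_cases m <;> norm_num
  · refine le_max_of_le_right (h.trans ?_)
    have h1 : (m + 10) ^ 2 / 4 + 4 ≤ (m + 12) * (m + 10) / 4 := by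
      rw [← Nat.add_mul_div_left _ _ (by norm_num : 0 < 4)]
      refine Nat.div_le_div_right ?_
      nlinarith
    omega

/-- In a triangle-free graph in which no neighbourhood contains another one, every edge misses at
least two vertices. Indeed, if only `r` is missed by `u v`, then `r` is adjacent to all neighbours
of `u` and `v` besides `u` and `v`, and at most five vertices are left by triangle-freeness. -/
theorem card_nbrs_add_add_two_le [Fintype V] (h : TriangleFreeOn G univ) (h6 : 6 ≤ Fintype.card V)
    (hnd : ∀ u w, u ≠ w → ∃ x, G.Adj w x ∧ ¬ G.Adj u x)
    (hdeg : ∀ v, 2 ≤ #(nbrs G univ v)) {u v : V} (huv : G.Adj u v) :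
    #(nbrs G univ u) + #(nbrs G univ v) + 2 ≤ Fintype.card V := by
  by_contra hcon
  have htri : ∀ x y z, G.Adj x y → G.Adj x z → ¬ G.Adj y z := fun x y z =>
    h x (mem_univ _) y (mem_univ _) z (mem_univ _)
  have hN : ∀ x y, y ∈ nbrs G univ x ↔ G.Adj x y := fun x y => by simp [mem_nbrs]
  have hdis := h.disjoint_nbrs (mem_univ u) (mem_univ v) huv
  set X := nbrs G univ v
  set Y := nbrs G univ u
  have hR : #(Y ∪ X)ᶜ ≤ 1 := by
    rw [card_compl, card_union_of_disjoint hdis]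
    omega
  have hout : ∀ p q, G.Adj p q → ∀ a, G.Adj q a → a ≠ p → ∃ x, G.Adj a x ∧ ¬ G.Adj p x ∧ ¬ G.Adj q x :=
    fun p q _ a hqa hap => by
      obtain ⟨x, hax, hpx⟩ := hnd p a hap.symm
      exact ⟨x, hax, hpx, fun hqx => htri q a x hqa hqx hax⟩
  have hmemR : ∀ x, ¬ G.Adj u x → ¬ G.Adj v x → x ∈ (Y ∪ X)ᶜ := fun x h1 h2 => by
    simp [Y, X, hN, h1, h2]
  obtain ⟨a₀, ha₀, ha₀u⟩ := exists_mem_ne (hdeg v) u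
  obtain ⟨b₀, hb₀, hb₀v⟩ := exists_mem_ne (hdeg u) v
  rw [hN] at ha₀ hb₀
  obtain ⟨r, -, hru, hrv⟩ := hout u v huv a₀ ha₀ ha₀u
  have hr : ∀ x, ¬ G.Adj u x → ¬ G.Adj v x → x = r := fun x h1 h2 =>
    card_le_one.1 hR x (hmemR x h1 h2) r (hmemR r hru hrv)
  have hXr : ∀ a, G.Adj v a → a ≠ u → G.Adj a r := fun a ha hau => by
    obtain ⟨x, hax, h1, h2⟩ := hout u v huv a ha hau
    exact hr x h1 h2 ▸ hax
  have hYr : ∀ b, G.Adj u b → b ≠ v → G.Adj b r := fun b hb hbv => by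
    obtain ⟨x, hbx, h1, h2⟩ := hout v u huv.symm b hb hbv
    exact hr x h2 h1 ▸ hbx
  have hcross : ∀ a b, G.Adj v a → a ≠ u → G.Adj u b → b ≠ v → ¬ G.Adj a b :=
    fun a b ha hau hb hbv hab => htri r a b (hXr a ha hau).symm (hYr b hb hbv).symm hab
  have hX1 : #(X.erase u) ≤ 1 := by
    refine card_le_one.2 fun a ha b hb => ?_
    rw [mem_erase, hN] at ha hb
    by_contra hab
    obtain ⟨x, hbx, hax⟩ := hnd a b hab
    by_cases hux : G.Adj u x
    · by_cases hxv : x = v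
      · exact hax (hxv ▸ ha.2.symm)
      · exact hcross b x hb.2 hb.1 hux hxv hbx
    · have hvx : ¬ G.Adj v x := fun hvx => htri v b x hb.2 hvx hbx
      exact hax (hr x hux hvx ▸ hXr a ha.2 ha.1)
  have hY1 : #(Y.erase v) ≤ 1 := by
    refine card_le_one.2 fun a ha b hb => ?_
    rw [mem_erase, hN] at ha hb
    by_contra hab
    obtain ⟨x, hbx, hax⟩ := hnd a b hab
    by_cases hvx : G.Adj v x
    · by_cases hxu : x = u
      · exact hax (hxu ▸ ha.2.symm)
      · exact hcross x b hvx hxu hb.2 hb.1 hbx.symm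
    · have hux : ¬ G.Adj u x := fun hux => htri u b x hb.2 hux hbx
      exact hax (hr x hux hvx ▸ hYr a ha.2 ha.1)
  have hX2 : #(X.erase u) + 1 = #X := card_erase_add_one ((hN v u).2 huv.symm)
  have hY2 : #(Y.erase v) + 1 = #Y := card_erase_add_one ((hN u v).2 huv)
  omega

/-- If no neighbourhood contains another one, all edges together with a last edge represented by
complementary sets give one label less than there are edges. -/
theorem overlapNumber_le_of_no_dominated [Fintype V] (h : TriangleFreeOn G univ)
    (h13 : 13 ≤ Fintype.card V) (hnd : ∀ u w, u ≠ w → ∃ x, G.Adj w x ∧ ¬ G.Adj u x) :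
    overlapNumber G ≤ max 41 (Fintype.card V * (Fintype.card V - 2) / 4 - 1) := by
  have htri : ∀ x y z, G.Adj x y → G.Adj x z → ¬ G.Adj y z := fun x y z =>
    h x (mem_univ _) y (mem_univ _) z (mem_univ _)
  have hN : ∀ x y, y ∈ nbrs G univ x ↔ G.Adj x y := fun x y => by simp [mem_nbrs]
  have hnb : ∀ w, ∃ x, G.Adj w x := by
    intro w
    obtain ⟨u, hu⟩ := Fintype.exists_ne_of_one_lt_card (by omega : 1 < Fintype.card V) w
    obtain ⟨x, hx, -⟩ := hnd u w hu
    exact ⟨x, hx⟩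
  by_cases hdeg : ∀ v, 2 ≤ #(nbrs G univ v)
  · obtain ⟨u⟩ : Nonempty V := Fintype.card_pos_iff.1 (by omega)
    obtain ⟨v, huv⟩ := hnb u
    have hmemK : ∀ x, x ∈ ({u, v} : Finset V) ↔ x = u ∨ x = v := fun x => by simp
    have hother : ∀ x ∈ ({u, v} : Finset V), ∃ y ∈ ({u, v} : Finset V), G.Adj x y := by
      intro x hx
      rcases (hmemK x).1 hx with rfl | rfl
      · exact ⟨v, by simp, huv⟩
      · exact ⟨u, by simp, huv.symm⟩
    have hK : ∀ x ∈ ({u, v} : Finset V), ∀ y ∈ ({u, v} : Finset V), x ≠ y → G.Adj x y := by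
      intro x hx y hy hxy
      rcases (hmemK x).1 hx with rfl | rfl <;> rcases (hmemK y).1 hy with rfl | rfl
      · exact absurd rfl hxy
      · exact huv
      · exact huv.symm
      · exact absurd rfl hxy
    have hpair : ∀ x ∉ ({u, v} : Finset V), ∀ y ∉ ({u, v} : Finset V), G.Adj x y →
        ({x, y} : Finset V) ∈ edgesIn G {u, v}ᶜ := fun x hx y hy hxy =>
      pair_mem_edgesIn (mem_compl.2 hx) (mem_compl.2 hy) hxy
    have hinner : ∀ x ∉ ({u, v} : Finset V), ∃ y ∉ ({u, v} : Finset V), G.Adj x y := by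
      intro x hx
      by_contra! hcon
      obtain ⟨a, ha, b, hb, hab⟩ := one_lt_card.1 (hdeg x)
      rw [hN] at ha hb
      have ha' : a ∈ ({u, v} : Finset V) := by_contra fun hn => hcon a hn ha
      have hb' : b ∈ ({u, v} : Finset V) := by_contra fun hn => hcon b hn hb
      exact htri x a b ha hb (hK a ha' b hb' hab)
    -- the other end of the edge has a neighbour outside, which is not adjacent to `x`
    have hpriv : ∀ x ∈ ({u, v} : Finset V), ∀ y ∈ ({u, v} : Finset V), x ≠ y →
        ∃ w ∉ ({u, v} : Finset V), G.Adj y w ∧ ¬ G.Adj x w := by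
      intro x hx y hy hxy
      obtain ⟨w, hw, hwx⟩ := exists_mem_ne (hdeg y) x
      rw [hN] at hw
      have hnx : ¬ G.Adj x w := htri y x w (hK y hy x hx hxy.symm) hw
      refine ⟨w, fun hwK => ?_, hw, hnx⟩
      exact hnx (hK x hx w hwK hwx.symm)
    have key := overlapNumber_le_of_last_clique (G := G) (K := {u, v}) (P := ∅)
      (𝒞 := edgesIn G {u, v}ᶜ) hK (empty_subset _) (fun C hC => (mem_edgesIn.1 hC).1.1)
      (fun C hC => (mem_edgesIn.1 hC).2)
      (fun x hx y hy hxy => ⟨_, hpair x hx y hy hxy, by simp, by simp⟩) ?_ ?_ ?_ ?_ ?_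
    · have h1 := card_edgesIn_sdiff_pair (G := G) (mem_univ u) (mem_univ v) huv.ne
      rw [← compl_eq_univ_sdiff] at h1
      have h2 : attached G {u, v}ᶜ {u, v} ⊆ (nbrs G univ u).erase v ∪ (nbrs G univ v).erase u := by
        intro w hw
        obtain ⟨hwK, x, hx, hxw⟩ := mem_attached.1 hw
        simp only [mem_compl, mem_insert, mem_singleton, not_or] at hwK
        rw [mem_union, mem_erase, mem_erase, hN, hN]
        rcases (hmemK x).1 hx with rfl | rfl
        · exact .inl ⟨hwK.2, hxw⟩
        · exact .inr ⟨hwK.1, hxw⟩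
      have h3 := (card_le_card h2).trans (card_union_le _ _)
      rw [card_erase_of_mem ((hN u v).2 huv), card_erase_of_mem ((hN v u).2 huv.symm)] at h3
      have h4 := four_mul_card_edgesIn_le (G := G) (S := univ) (M := Fintype.card V - 2)
        fun x _ y _ hxy => by
          have := card_nbrs_add_add_two_le h (by omega) hnd hdeg hxy
          omega
      rw [card_univ] at h4
      have h5 := hdeg u
      have h6 := hdeg v
      rw [card_empty] at key
      refine le_max_of_le_right ?_
      omega
    · intro x hx y hy hxy hnot
      obtain ⟨z, hz, hzy⟩ := exists_mem_ne (hdeg x) y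
      rw [hN] at hz
      exact ⟨_, hpair x hx z (fun hzK => hnot z hzK hz.symm) hz, by simp,
        by simp [hxy.ne', hzy.symm]⟩
    · intro x hx
      obtain ⟨y, hy, hxy⟩ := hinner x hx
      exact ⟨_, hpair x hx y hy hxy, by simp⟩
    · obtain ⟨w, hw, -⟩ := hpriv u (by simp) v (by simp) huv.ne
      obtain ⟨y, hy, hwy⟩ := hinner w hw
      exact ⟨_, hpair w hw y hy hwy⟩
    · intro x hx w hw hxw
      obtain ⟨y, hy, hxy⟩ := hother x hx
      obtain ⟨w', hw', h1, h2⟩ := hpriv x hx y hy hxy.ne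
      exact .inr ⟨w', mem_attached.2 ⟨mem_compl.2 hw', y, hy, h1⟩, h2⟩
    · exact fun x hx y hy hxy => .inr (hpriv x hx y hy hxy)
  · -- a vertex `w` of degree one forms a component together with its neighbour `z`
    push Not at hdeg
    obtain ⟨w, hw⟩ := hdeg
    obtain ⟨z, hwz⟩ := hnb w
    have hw1 : ∀ x, G.Adj w x → x = z := fun x hx =>
      card_le_one.1 (Nat.le_of_lt_succ hw) x ((hN w x).2 hx) z ((hN w z).2 hwz)
    have hz1 : ∀ x, G.Adj z x → x = w := fun x hx => by
      by_contra hne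
      obtain ⟨y, hy, hny⟩ := hnd x w hne
      exact hny (hw1 y hy ▸ hx.symm)
    have hatt : attached G (univ \ {w, z}) {w, z} = ∅ := by
      refine eq_empty_of_forall_notMem fun y hy => ?_
      obtain ⟨hy, x, hx, hxy⟩ := mem_attached.1 hy
      simp only [mem_sdiff, mem_univ, true_and, mem_insert, mem_singleton, not_or] at hx hy
      rcases hx with rfl | rfl
      · exact hy.2 (hw1 y hxy)
      · exact hy.1 (hz1 y hxy)
    have hcard : #(univ \ {w, z} : Finset V) = Fintype.card V - 2 := by
      rw [card_sdiff_of_subset (subset_univ _), card_univ, card_pair hwz.ne]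
    have hcov := hasSepCover_of_clique (G := G) (K := {w, z}) (subset_univ _) ?_
      (hasSepCover_sq_div_four G (by rw [hcard]; omega)) {{w, z}, {w}, {z}} (by simp) ?_ ?_ ?_
    · refine hcov.overlapNumber_le.trans (le_max_of_le_sq_div_four_add_three (by omega) ?_)
      rw [hatt, hcard, card_empty, add_zero]
      exact Nat.add_le_add_left card_le_three _
    · intro a ha b hb hab
      simp only [mem_insert, mem_singleton] at ha hb
      rcases ha with rfl | rfl <;> rcases hb with rfl | rfl
      · exact absurd rfl hab
      · exact hwz
      · exact hwz.symm
      · exact absurd rfl hab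
    · exact fun a ha b hb _ => .inl ⟨{w, z}, by simp, ha, hb⟩
    · intro a ha b _ hab
      refine .inl ⟨{a}, ?_, by simp, by simpa using hab.symm⟩
      simp only [mem_insert, mem_singleton] at ha
      rcases ha with rfl | rfl <;> simp
    · exact fun a ha => .inl ⟨{w, z}, by simp, ha⟩

/-- If the neighbourhood of `w` is contained in that of another vertex, then `w` costs only one
label, and the rest of the graph spans too few edges: otherwise it contains many vertices with a
common neighbourhood, two of which are also treated alike by `w`. -/
theorem overlapNumber_le_of_exists_dominated [Fintype V] (h : TriangleFreeOn G univ)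
    (h13 : 13 ≤ Fintype.card V) (htw : ∀ a b, (∀ x, G.Adj a x ↔ G.Adj b x) → a = b)
    {u w : V} (huw : u ≠ w) (hdom : ∀ x, G.Adj w x → G.Adj u x) :
    overlapNumber G ≤ max 41 (Fintype.card V * (Fintype.card V - 2) / 4 - 1) := by
  have hS : TriangleFreeOn G (univ.erase w) := h.mono (subset_univ _)
  have hcard : #(univ.erase w : Finset V) = Fintype.card V - 1 := by
    rw [card_erase_of_mem (mem_univ w), card_univ]
  have key := overlapNumber_le_of_dominated huw hdom (isSepCover_edgeCover G (univ.erase w))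
    fun C hC => card_le_two_of_mem_edgeCover hC
  have key' := card_edgeCover_le G (univ.erase w)
  by_cases hl : 1 ≤ #(leavesIn G (univ.erase w))
  · have h1 := hS.card_edgesIn_add_card_leavesIn_le_of_leaf (by omega) hl
    rw [hcard] at h1
    exact le_max_of_le_sq_div_four_add_three (by omega)
      (by simp only [Nat.sub_sub, Nat.reduceAdd] at h1; omega)
  by_contra hcon
  have hb : Fintype.card V * (Fintype.card V - 2) / 4 - 1 ≤ #(edgesIn G (univ.erase w)) := by
    have := le_max_right 41 (Fintype.card V * (Fintype.card V - 2) / 4 - 1)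
    omega
  have hq : #(univ.erase w : Finset V) ^ 2 / 4 ≤ #(edgesIn G (univ.erase w)) + 2 ∧
      #(univ.erase w : Finset V) * (#(univ.erase w : Finset V) - 1) <
        4 * #(edgesIn G (univ.erase w)) := by
    generalize #(edgesIn G (univ.erase w)) = e at *
    rw [hcard]
    generalize Fintype.card V = n at *
    obtain ⟨m, rfl⟩ := Nat.exists_eq_add_of_le' h13
    simp only [Nat.add_sub_assoc, Nat.reduceLeDiff, Nat.reduceSub] at *
    obtain ⟨k, rfl | rfl⟩ := Nat.even_or_odd' m
    · have h1 : (2 * k + 13) * (2 * k + 11) / 4 = (k + 6) * (k + 6) - 1 := by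
        rw [show (2 * k + 13) * (2 * k + 11) = 4 * (k * k + 12 * k + 35) + 3 by ring,
          show (k + 6) * (k + 6) = k * k + 12 * k + 36 by ring]
        omega
      rw [h1] at hb
      rw [show 2 * k + 12 = 2 * (k + 6) by ring, even_sq_div_four]
      refine ⟨by omega, ?_⟩
      have : (k + 6) * (k + 6) ≤ e + 2 := by omega
      nlinarith
    · have h1 : (2 * k + 1 + 13) * (2 * k + 1 + 11) / 4 = (k + 6) * (k + 6) + (k + 6) := by
        rw [show (2 * k + 1 + 13) * (2 * k + 1 + 11) = 4 * ((k + 6) * (k + 6) + (k + 6)) by ring]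
        omega
      rw [h1] at hb
      rw [show 2 * k + 1 + 12 = 2 * (k + 6) + 1 by ring, odd_sq_div_four]
      refine ⟨by omega, ?_⟩
      have : (k + 6) * (k + 6) + (k + 6) ≤ e + 1 := by omega
      nlinarith
  obtain ⟨A, hAS, hA, hAcard⟩ := hS.exists_common_nbrs hq.2
  obtain ⟨a, ha, b, hb', hab, hadj⟩ := exists_ne_map_eq_of_card_lt_of_maps_to
    (s := A) (t := (univ : Finset Prop)) (f := fun a => G.Adj w a)
    (by rw [card_univ, Fintype.card_prop]; omega) (fun _ _ => mem_univ _)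
  refine hab (htw a b fun x => ?_)
  by_cases hx : x = w
  · subst hx
    rw [G.adj_comm a, G.adj_comm b]
    exact iff_of_eq hadj
  · exact hA a ha b hb' x (by simp [hx])

/-! ### Graphs with a triangle -/

/-- Two vertices of a triangle without neighbours outside it cost only three labels. -/
theorem overlapNumber_le_of_pendant_triangle [Fintype V] (h12 : 12 ≤ Fintype.card V) {u v z : V}
    (huv : G.Adj u v) (huz : G.Adj u z) (hvz : G.Adj v z)
    (hu : ∀ x, G.Adj u x → x = v ∨ x = z) (hv : ∀ x, G.Adj v x → x = u ∨ x = z) :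
    overlapNumber G ≤ max 41 (Fintype.card V * (Fintype.card V - 2) / 4 - 1) := by
  have hcard : #(univ \ {u, v} : Finset V) = Fintype.card V - 2 := by
    rw [card_sdiff_of_subset (subset_univ _), card_univ, card_pair huv.ne]
  have hcov := hasSepCover_of_edge (P := {u, v}) (mem_univ u) (mem_univ v) huv (mem_univ z) huz hvz
    Subset.rfl (.inl (by simp)) (.inl (by simp))
    (hasSepCover_sq_div_four G (by rw [hcard]; omega))
  refine hcov.overlapNumber_le.trans (le_max_of_le_sq_div_four_add_three h12 ?_)
  have hatt : attached G (univ \ {u, v}) {u, v} ⊆ {z} := by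
    intro y hy
    obtain ⟨hy, x, hx, hxy⟩ := mem_attached.1 hy
    simp only [mem_sdiff, mem_univ, true_and, mem_insert, mem_singleton, not_or] at hx hy ⊢
    rcases hx with rfl | rfl
    · exact (hu y hxy).resolve_left hy.2
    · exact (hv y hxy).resolve_left hy.1
  have h1 := card_le_card hatt
  have h2 : #({u, v} : Finset V) ≤ 2 := card_le_two
  rw [card_singleton] at h1
  rw [hcard]
  omega

/-- The case in which every triangle meets all others and there is no 4-clique containing the triangle
`κ`. The set `A` of vertices with a common neighbourhood outside the triangle is embedded into the
sets of neighbours in the triangle. If `p` vertices of the triangle need a private label, then at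
most 6, 4 or 3 nonempty sets are possible for `p = 0, 1, 2`. This is too few, except when `p = 0` and
all six sets occur, and then there are two disjoint triangles. -/
theorem overlapNumber_le_of_triangle [Fintype V] (h14 : 14 ≤ Fintype.card V)
    (htw : ∀ a b, (∀ x, G.Adj a x ↔ G.Adj b x) → a = b)
    {κ : Fin 3 → V} (hκ : ∀ i j, i ≠ j → G.Adj (κ i) (κ j)) (h4 : ∀ a, ∃ i, ¬ G.Adj (κ i) a)
    (hdisj : ∀ x y z, G.Adj x y → G.Adj x z → G.Adj y z → TriangleFreeOn G {x, y, z}ᶜ) :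
    overlapNumber G ≤ max 41 (Fintype.card V * (Fintype.card V - 2) / 4 - 1) := by
  have hinj : Function.Injective κ := fun i j hij => by
    by_contra hne
    exact (hκ i j hne).ne hij
  set K : Finset V := univ.image κ
  have hmemK : ∀ x, x ∈ K ↔ ∃ i, κ i = x := fun x => by simp [K]
  have hK : ∀ x ∈ K, ∀ y ∈ K, x ≠ y → G.Adj x y := by
    intro x hx y hy hxy
    obtain ⟨i, rfl⟩ := (hmemK x).1 hx
    obtain ⟨j, rfl⟩ := (hmemK y).1 hy
    exact hκ i j fun h => hxy (h ▸ rfl)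
  have hKcard : #K = 3 := by rw [card_image_of_injective _ hinj, card_univ, Fintype.card_fin]
  have hScard : #Kᶜ + 3 = Fintype.card V := by rw [card_compl, hKcard]; omega
  have hS : TriangleFreeOn G Kᶜ := by
    refine (hdisj (κ 0) (κ 1) (κ 2) (hκ _ _ (by decide)) (hκ _ _ (by decide))
      (hκ _ _ (by decide))).mono fun x hx => ?_
    have hx' : ∀ i, x ≠ κ i := fun i h => mem_compl.1 hx ((hmemK x).2 ⟨i, h.symm⟩)
    simp [hx']
  -- the type of `a` is its set of neighbours in the triangle
  let t : V → Finset (Fin 3) := fun a => {i | G.Adj (κ i) a}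
  have ht : ∀ a i, i ∈ t a ↔ G.Adj (κ i) a := fun a i => by simp [t]
  have htu : ∀ a, t a ≠ univ := fun a h => by
    obtain ⟨i, hi⟩ := h4 a
    exact hi ((ht a i).1 (h ▸ mem_univ i))
  -- the vertices of the triangle that need a private label
  let I : Finset (Fin 3) := {i | ∃ j, j ≠ i ∧ ∀ w ∉ K, G.Adj (κ j) w → G.Adj (κ i) w}
  have hI : ∀ i, i ∈ I ↔ ∃ j, j ≠ i ∧ ∀ w ∉ K, G.Adj (κ j) w → G.Adj (κ i) w := fun i => by simp [I]
  by_cases hI3 : #I = 3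
  · have hall : ∀ i, ∃ j, j ≠ i ∧ ∀ w ∉ K, G.Adj (κ j) w → G.Adj (κ i) w := by
      have : I = univ := eq_univ_of_card _ (by simpa using hI3)
      exact fun i => (hI i).1 (this ▸ mem_univ i)
    choose y hy hyw using hall
    obtain ⟨c, hc⟩ := exists_subset_singleton_of_types y hy
    have hout : ∀ i, i ≠ c → ∀ w ∉ K, ¬ G.Adj (κ i) w := by
      intro i hi w hw hadj
      have := hc (t w) (htu w) (fun x hx => (ht w x).2 (hyw x w hw ((ht w _).1 hx)))
        ((ht w i).2 hadj)
      exact hi (mem_singleton.1 this)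
    obtain ⟨a, b, hac, hbc, hab⟩ := exists_other_two c
    have hrest : ∀ i j : Fin 3, i ≠ c → j ≠ c → i ≠ j → ∀ x, G.Adj (κ i) x →
        x = κ j ∨ x = κ c := by
      intro i j hi hj hij x hx
      obtain ⟨l, rfl⟩ := (hmemK x).1 (by_contra fun hxK => hout i hi x hxK hx)
      have hli : l ≠ i := fun h => G.irrefl (h ▸ hx)
      have : l = j ∨ l = c := by omega
      exact this.imp (congrArg κ) (congrArg κ)
    exact overlapNumber_le_of_pendant_triangle (by omega) (hκ a b hab) (hκ a c hac) (hκ b c hbc)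
      (hrest a b hac hbc hab) (hrest b a hbc hac hab.symm)
  have hI2 : #I ≤ 2 := by
    have h1 : #I ≤ 3 := by simpa using card_le_univ I
    omega
  have hne : ∀ w, ∃ x ∈ Kᶜ, x ≠ w := fun w => exists_mem_ne (by omega) w
  have hcov := isSepCover_edgeCover G Kᶜ
  have key := overlapNumber_le_of_last_clique (G := G) (K := K) (P := I.image κ)
    (𝒞 := edgeCover G Kᶜ) hK (image_subset_image (subset_univ _)) hcov.subset hcov.clique
    (fun x hx y hy => hcov.cover x (mem_compl.2 hx) y (mem_compl.2 hy))
    (fun x hx y hy hxy _ => hcov.sep x (mem_compl.2 hx) y (mem_compl.2 hy) hxy)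
    (fun x hx => hcov.mem x (mem_compl.2 hx)) ?_ ?_ ?_
  rotate_left
  · obtain ⟨x, hx, -⟩ := hne (κ 0)
    obtain ⟨C, hC, -⟩ := hcov.mem x hx
    exact ⟨C, hC⟩
  · intro x _ w hw _
    obtain ⟨w', hw', hne'⟩ := hne w
    obtain ⟨C, hC, -, h⟩ := hcov.exists_notMem hw' (mem_compl.2 hw) hne'
    exact .inl ⟨C, hC, h⟩
  · intro x hx y hy hxy
    obtain ⟨i, rfl⟩ := (hmemK x).1 hx
    obtain ⟨j, rfl⟩ := (hmemK y).1 hy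
    by_cases hi : i ∈ I
    · exact .inl (mem_image_of_mem _ hi)
    · rw [hI] at hi
      push Not at hi
      exact .inr (hi j fun h => hxy (h ▸ rfl))
  have hPcard : #(I.image κ) ≤ #I := card_image_le
  have hedge := card_edgeCover_le G Kᶜ
  have hatt : #(attached G Kᶜ K) + #{a ∈ Kᶜ | t a = ∅} ≤ #Kᶜ := by
    rw [← card_filter_add_card_filter_not (s := Kᶜ) (fun a => t a = ∅), add_comm]
    refine Nat.add_le_add_left (card_le_card fun w hw => ?_) _
    obtain ⟨hw, x, hx, hxw⟩ := mem_attached.1 hw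
    obtain ⟨i, rfl⟩ := (hmemK x).1 hx
    exact mem_filter.2 ⟨hw, ne_empty_of_mem ((ht w i).2 hxw)⟩
  have hh : 11 ≤ #Kᶜ := by omega
  by_cases hl : 1 ≤ #(leavesIn G Kᶜ)
  · have h1 := hS.card_edgesIn_add_card_leavesIn_le_of_leaf (by omega) hl
    refine le_max_of_le_right ?_
    have h2 : overlapNumber G ≤ (#Kᶜ - 1) ^ 2 / 4 + 2 + #Kᶜ + 2 := by omega
    refine h2.trans ?_
    rw [← hScard]
    generalize #Kᶜ = h at hh
    obtain ⟨m, rfl⟩ := Nat.exists_eq_add_of_le' hh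
    simp only [Nat.add_sub_assoc, Nat.reduceLeDiff, Nat.reduceSub, add_assoc, Nat.reduceAdd]
    have h3 : (m + 10) ^ 2 / 4 + (m + 16) ≤ (m + 14) * (m + 12) / 4 := by
      rw [← Nat.add_mul_div_left _ _ (by norm_num : 0 < 4)]
      refine Nat.div_le_div_right ?_
      nlinarith
    omega
  by_contra hcon
  have hb := le_max_right 41 (Fintype.card V * (Fintype.card V - 2) / 4 - 1)
  have hU : #(edgesIn G Kᶜ) + #I ≥ #Kᶜ ^ 2 / 4 + #{a ∈ Kᶜ | t a = ∅} + #Kᶜ % 2 ∧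
      #(edgesIn G Kᶜ) ≤ #Kᶜ ^ 2 / 4 ∧ #Kᶜ * (#Kᶜ - 1) < 4 * #(edgesIn G Kᶜ) := by
    have h1 : Fintype.card V * (Fintype.card V - 2) / 4 - 1 < #(edgesIn G Kᶜ) + #Kᶜ + #I -
      #{a ∈ Kᶜ | t a = ∅} := by omega
    have h2 := hS.four_mul_card_edgesIn_le
    rw [← hScard] at h1
    have h3 : #{a ∈ Kᶜ | t a = ∅} ≤ #Kᶜ := by omega
    generalize #(edgesIn G Kᶜ) = e at *
    generalize #{a ∈ Kᶜ | t a = ∅} = U at *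
    generalize #Kᶜ = h at *
    obtain ⟨k, rfl | rfl⟩ := Nat.even_or_odd' h
    · rw [even_sq_div_four]
      have h5 : (2 * k + 3) * (2 * k + 3 - 2) / 4 = k * k + 2 * k := by
        rw [show 2 * k + 3 - 2 = 2 * k + 1 by omega,
          show (2 * k + 3) * (2 * k + 1) = 4 * (k * k + 2 * k) + 3 by ring]
        omega
      rw [h5] at h1
      have h6 : k * k + U ≤ e + #I := by omega
      refine ⟨by omega, by nlinarith, ?_⟩
      rw [Nat.mul_sub_one]
      have h7 : 2 * k * (2 * k) = 4 * (k * k) := by ring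
      have h8 : 6 * k ≤ k * k := Nat.mul_le_mul_right k (by omega)
      omega
    · rw [odd_sq_div_four]
      have h5 : (2 * k + 1 + 3) * (2 * k + 1 + 3 - 2) / 4 = k * k + 3 * k + 2 := by
        rw [show 2 * k + 1 + 3 - 2 = 2 * k + 2 by omega,
          show (2 * k + 1 + 3) * (2 * k + 2) = 4 * (k * k + 3 * k + 2) by ring]
        omega
      rw [h5] at h1
      have h6 : k * k + k + U + 1 ≤ e + #I := by omega
      have h8 : (2 * k + 1) * (2 * k + 1) = 4 * (k * k) + 4 * k + 1 := by ring
      refine ⟨by omega, by omega, ?_⟩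
      rw [Nat.mul_sub_one]
      omega
  obtain ⟨hU, hmantel, hlarge⟩ := hU
  obtain ⟨A, hAS, hA, hAcard⟩ := hS.exists_common_nbrs hlarge
  have htinj : Set.InjOn t A := by
    intro a ha b hb hab
    refine htw a b fun x => ?_
    by_cases hx : x ∈ K
    · obtain ⟨i, rfl⟩ := (hmemK x).1 hx
      rw [G.adj_comm a, G.adj_comm b, ← ht, ← ht, hab]
    · exact hA a ha b hb x (mem_compl.2 hx)
  have hcount : ∀ 𝒯 : Finset (Finset (Fin 3)), (∀ a ∈ Kᶜ, t a ≠ ∅ → t a ∈ 𝒯) →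
      #A ≤ #𝒯 + #{a ∈ Kᶜ | t a = ∅} := by
    intro 𝒯 h𝒯
    rw [← card_filter_add_card_filter_not (s := A) (fun a => t a = ∅), add_comm]
    refine Nat.add_le_add ?_ (card_le_card (filter_subset_filter _ hAS))
    refine card_le_card_of_injOn t (fun a ha => ?_) (htinj.mono fun x hx => ?_)
    · have ha' := mem_filter.1 (mem_coe.1 ha)
      exact h𝒯 a (hAS ha'.1) ha'.2
    · exact (mem_filter.1 (mem_coe.1 hx)).1
  obtain hI0 | hI1 | hI2 : #I = 0 ∨ #I = 1 ∨ #I = 2 := by omega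
  · -- all six types occur in `A`, and every vertex outside the triangle has a neighbour in it
    have hA6 : A.image t = ({T | T ≠ ∅ ∧ T ≠ univ} : Finset (Finset (Fin 3))) := by
      have hU0 : #{a ∈ Kᶜ | t a = ∅} = 0 := by omega
      refine eq_of_subset_of_card_le (fun T hT => ?_) ?_
      · obtain ⟨a, ha, rfl⟩ := mem_image.1 hT
        refine mem_filter.2 ⟨mem_univ _, fun h0 => ?_, htu a⟩
        exact notMem_empty a (card_eq_zero.1 hU0 ▸ mem_filter.2 ⟨hAS ha, h0⟩)
      · rw [card_image_of_injOn htinj]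
        have := card_types
        convert (show 6 ≤ #A by omega)
    have htype : ∀ T : Finset (Fin 3), T ≠ ∅ → T ≠ univ → ∃ a ∈ A, t a = T := by
      intro T h1 h2
      have : T ∈ A.image t := hA6 ▸ mem_filter.2 ⟨mem_univ _, h1, h2⟩
      exact mem_image.1 this
    obtain ⟨a, ha, -⟩ := htype {0} (by decide) (by decide)
    obtain ⟨b, hb⟩ : ∃ b, b ∈ nbrs G Kᶜ a := by
      have hnl : a ∉ leavesIn G Kᶜ := fun h => hl (card_pos.2 ⟨a, h⟩)
      have : ¬ #(nbrs G Kᶜ a) ≤ 1 := fun h => hnl (mem_filter.2 ⟨hAS ha, h⟩)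
      exact card_pos.1 (by omega)
    obtain ⟨hbS, hab⟩ := mem_nbrs.1 hb
    obtain ⟨i, hi⟩ : (t b).Nonempty := by
      by_contra h0
      rw [not_nonempty_iff_eq_empty] at h0
      have hU0 : #{a ∈ Kᶜ | t a = ∅} = 0 := by omega
      exact notMem_empty b (card_eq_zero.1 hU0 ▸ mem_filter.2 ⟨hbS, h0⟩)
    obtain ⟨j, k, hji, hki, hjk⟩ := exists_other_two i
    obtain ⟨a₁, ha₁, hta₁⟩ := htype {i} (singleton_ne_empty i) (fun h => by
      have : j ∈ ({i} : Finset (Fin 3)) := h ▸ mem_univ j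
      exact hji (mem_singleton.1 this))
    obtain ⟨a₂, ha₂, hta₂⟩ := htype {j, k} (insert_ne_empty _ _) (fun h => by
      have : i ∈ ({j, k} : Finset (Fin 3)) := h ▸ mem_univ i
      simp [hji.symm, hki.symm] at this)
    have hab₁ : G.Adj a₁ b := (hA a ha a₁ ha₁ b hbS).1 hab
    have hab₂ : G.Adj a₂ b := (hA a ha a₂ ha₂ b hbS).1 hab
    have ht₁ : i ∈ t a₁ := by simp [hta₁]
    have htj : j ∈ t a₂ := by simp [hta₂]
    have htk : k ∈ t a₂ := by simp [hta₂]
    have hne : a₁ ≠ a₂ := by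
      rintro rfl
      rw [hta₁, mem_singleton] at htj
      exact hji htj
    have hnK : ∀ x ∈ Kᶜ, ∀ l, x ≠ κ l := fun x hx l h => mem_compl.1 hx ((hmemK x).2 ⟨l, h.symm⟩)
    -- the triangles `κ j, κ k, a₂` and `κ i, a₁, b` are disjoint
    refine hdisj (κ j) (κ k) a₂ (hκ j k hjk) ((ht _ _).1 htj) ((ht _ _).1 htk) (κ i) ?_ a₁ ?_ b ?_
      ((ht _ _).1 ht₁) ((ht _ _).1 hi) hab₁
    · simp [hinj.eq_iff, hji.symm, hki.symm, (hnK a₂ (hAS ha₂) i).symm]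
    · simp [hnK a₁ (hAS ha₁), hne]
    · simp [hnK b hbS, hab₂.ne']
  · obtain ⟨i, hi⟩ := card_pos.1 (show 0 < #I by omega)
    obtain ⟨j, hji, hj⟩ := (hI i).1 hi
    have h1 := hcount {T : Finset (Fin 3) | T ≠ ∅ ∧ T ≠ univ ∧ (j ∈ T → i ∈ T)} fun a ha h0 =>
      mem_filter.2 ⟨mem_univ _, h0, htu a, fun h =>
        (ht a i).2 (hj a (mem_compl.1 ha) ((ht a j).1 h))⟩
    have h2 := card_types_le' i j hji.symm
    have h3 : #A ≤ 4 + #{a ∈ Kᶜ | t a = ∅} := h1.trans (Nat.add_le_add_right (by convert h2) _)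
    omega
  · obtain ⟨i, hi, i', hi', hii'⟩ := one_lt_card.1 (show 1 < #I by omega)
    obtain ⟨j, hji, hj⟩ := (hI i).1 hi
    obtain ⟨j', hji', hj'⟩ := (hI i').1 hi'
    have h1 := hcount {T : Finset (Fin 3) | T ≠ ∅ ∧ T ≠ univ ∧ (j ∈ T → i ∈ T) ∧ (j' ∈ T → i' ∈ T)}
      fun a ha h0 => mem_filter.2 ⟨mem_univ _, h0, htu a, fun h =>
        (ht a i).2 (hj a (mem_compl.1 ha) ((ht a j).1 h)), fun h =>
        (ht a i').2 (hj' a (mem_compl.1 ha) ((ht a j').1 h))⟩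
    have h2 := card_types_le i j i' j' hji.symm hji'.symm hii'
    have h3 : #A ≤ 3 + #{a ∈ Kᶜ | t a = ∅} := h1.trans (Nat.add_le_add_right (by convert h2) _)
    omega

/-! ### The induction over the number of vertices -/

/-- Removing twins may lead below fourteen vertices, so the induction runs over all graphs, with the
value `41` that the bound takes at fourteen vertices as a floor. -/
theorem overlapNumber_le_max (n : ℕ) {V : Type*} [Fintype V] (G : SimpleGraph V)
    (hn : Fintype.card V = n) : overlapNumber G ≤ max 41 (n * (n - 2) / 4 - 1) := by
  induction n using Nat.strong_induction_on generalizing V with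
  | _ n ih =>
  by_cases htw : ∀ a b, (∀ x, G.Adj a x ↔ G.Adj b x) → a = b
  swap
  · push Not at htw
    obtain ⟨a, b, h, hab⟩ := htw
    have hcard : Fintype.card {x // x ≠ b} = n - 1 := by
      rw [Fintype.card_subtype_compl, Fintype.card_subtype_eq, hn]
    have hpos : 0 < n := hn ▸ Fintype.card_pos_iff.2 ⟨a⟩
    refine (overlapNumber_le_of_twins hab h).trans ((ih (n - 1) (by omega) _ hcard).trans ?_)
    have : (n - 1) * (n - 1 - 2) / 4 ≤ n * (n - 2) / 4 :=
      Nat.div_le_div_right (Nat.mul_le_mul (by omega) (by omega))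
    omega
  have huniv : #(univ : Finset V) = n := by rw [card_univ, hn]
  obtain h8 | h8 := Nat.lt_or_ge n 8
  · refine le_max_of_le_left ((hasSepCover_coverBound G univ).overlapNumber_le.trans ?_)
    rw [huniv]
    interval_cases n <;> simp [coverBound]
  obtain h12 | h13 := Nat.lt_or_ge n 13
  · refine le_max_of_le_left ((hasSepCover_sq_div_four G (by omega)).overlapNumber_le.trans ?_)
    rw [huniv]
    interval_cases n <;> norm_num
  by_cases htf : TriangleFreeOn G univ
  · subst hn
    by_cases hnd : ∀ u w, u ≠ w → ∃ x, G.Adj w x ∧ ¬ G.Adj u x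
    · exact overlapNumber_le_of_no_dominated htf h13 hnd
    · push Not at hnd
      obtain ⟨u, w, huw, hdom⟩ := hnd
      exact overlapNumber_le_of_exists_dominated htf h13 htw huw hdom
  have hcardK : ∀ K : Finset V, #(univ \ K) = n - #K := fun K => by
    rw [card_sdiff_of_subset (subset_univ _), huniv]
  have htriple : ∀ x y z, G.Adj x y → G.Adj x z → G.Adj y z → #({x, y, z} : Finset V) = 3 :=
    fun x y z hxy hxz hyz => card_eq_three.2 ⟨x, y, z, hxy.ne, hxz.ne, hyz.ne, rfl⟩
  simp only [TriangleFreeOn] at htf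
  push Not at htf
  obtain ⟨x, -, y, -, z, -, hxy, hxz, hyz⟩ := htf
  obtain rfl | h14 := h13.eq_or_lt
  · have h3 := htriple x y z hxy hxz hyz
    have := hasSepCover_of_three_le_card (subset_univ _) h3.ge (adj_of_mem_triple hxy hxz hyz)
      (hasSepCover_sq_div_four G (by rw [hcardK, h3]; norm_num))
    refine le_max_of_le_left (this.overlapNumber_le.trans ?_)
    rw [hcardK, h3, huniv]
    norm_num
  obtain ⟨m, rfl⟩ := Nat.exists_eq_add_of_le' (show 14 ≤ n from h14)
  by_cases h4 : ∃ a, G.Adj x a ∧ G.Adj y a ∧ G.Adj z a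
  · obtain ⟨a, hxa, hya, hza⟩ := h4
    have hcl : ∀ p ∈ ({a, x, y, z} : Finset V), ∀ q ∈ ({a, x, y, z} : Finset V), p ≠ q →
        G.Adj p q := by
      have h3 := adj_of_mem_triple hxy hxz hyz
      have ha : ∀ p ∈ ({x, y, z} : Finset V), G.Adj p a := by
        intro p hp
        simp only [mem_insert, mem_singleton] at hp
        rcases hp with rfl | rfl | rfl <;> assumption
      intro p hp q hq hpq
      rw [mem_insert] at hp hq
      rcases hp with rfl | hp <;> rcases hq with rfl | hq
      · exact absurd rfl hpq
      · exact (ha q hq).symm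
      · exact ha p hp
      · exact h3 p hp q hq hpq
    have hc : #({a, x, y, z} : Finset V) = 4 := by
      rw [card_insert_of_notMem (by simp [hxa.ne', hya.ne', hza.ne']), htriple x y z hxy hxz hyz]
    have := hasSepCover_of_three_le_card (subset_univ _) (by omega) hcl
      (hasSepCover_sq_div_four G (by rw [hcardK, hc]; omega))
    refine le_max_of_le_right (this.overlapNumber_le.trans ?_)
    rw [hcardK, hc, huniv, show m + 14 - 4 = m + 10 by omega, show m + 14 - 2 = m + 12 by omega]
    have h3 : (m + 10) ^ 2 / 4 + (m + 15) ≤ (m + 14) * (m + 12) / 4 := by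
      rw [← Nat.add_mul_div_left _ _ (by norm_num : 0 < 4)]
      exact Nat.div_le_div_right (by nlinarith)
    omega
  by_cases hdisj : ∀ x y z, G.Adj x y → G.Adj x z → G.Adj y z → TriangleFreeOn G {x, y, z}ᶜ
  · push Not at h4
    rw [← hn]
    refine overlapNumber_le_of_triangle (by omega) htw (κ := ![x, y, z]) ?_ ?_ hdisj
    · simp [Fin.forall_fin_succ, hxy, hxz, hyz, hxy.symm, hxz.symm, hyz.symm]
    · intro a
      by_contra! hcon
      exact h4 a (hcon 0) (hcon 1) (hcon 2)
  · simp only [TriangleFreeOn] at hdisj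
    push Not at hdisj
    obtain ⟨p, q, r, hpq, hpr, hqr, p', hp', q', hq', r', hr', hpq', hpr', hqr'⟩ := hdisj
    have hc := htriple p q r hpq hpr hqr
    have hc' := htriple p' q' r' hpq' hpr' hqr'
    have hsub : ({p', q', r'} : Finset V) ⊆ univ \ {p, q, r} := by
      rw [← compl_eq_univ_sdiff]
      simp only [insert_subset_iff, singleton_subset_iff]
      exact ⟨hp', hq', hr'⟩
    have h1 : #((univ \ {p, q, r}) \ {p', q', r'} : Finset V) = m + 8 := by
      rw [card_sdiff_of_subset hsub, hcardK, hc, hc']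
      omega
    have := hasSepCover_of_three_le_card (subset_univ _) hc.ge (adj_of_mem_triple hpq hpr hqr)
      (hasSepCover_of_three_le_card hsub hc'.ge (adj_of_mem_triple hpq' hpr' hqr')
        (hasSepCover_sq_div_four G (by omega)))
    refine le_max_of_le_right (this.overlapNumber_le.trans ?_)
    rw [h1, hcardK, hc, huniv, show m + 14 - 3 = m + 11 by omega,
      show m + 14 - 2 = m + 12 by omega]
    -- rounding matters here: the two sides agree for fourteen and fifteen vertices
    have h3 : (m + 8) ^ 2 / 4 + (m + 11) + (m + 14) + 1 ≤ (m + 14) * (m + 12) / 4 := by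
      obtain ⟨k, rfl | rfl⟩ := Nat.even_or_odd' m
      · rw [show 2 * k + 8 = 2 * (k + 4) by ring, even_sq_div_four,
          show (2 * k + 14) * (2 * k + 12) = 4 * ((k + 4) * (k + 4) + 5 * k + 26) by ring]
        omega
      · rw [show 2 * k + 1 + 8 = 2 * (k + 4) + 1 by ring, odd_sq_div_four,
          show (2 * k + 1 + 14) * (2 * k + 1 + 12) =
            4 * ((k + 4) * (k + 4) + 6 * k + 32) + 3 by ring]
        omega
    omega

end OverlapBound

theorem mainTheorem4 {V : Type*} [Fintype V] (G : SimpleGraph V) (n : ℕ)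
    (hn : Fintype.card V = n) (h14 : 14 ≤ n) :
    (overlapNumber G : ℤ) ≤ ⌊(n : ℝ) ^ 2 / 4 - (n : ℝ) / 2 - 1⌋ := by
  have h1 := OverlapBound.overlapNumber_le_max n G hn
  obtain ⟨m, rfl⟩ := Nat.exists_eq_add_of_le' h14
  have h2 : 42 ≤ (m + 14) * (m + 14 - 2) / 4 := by
    rw [Nat.le_div_iff_mul_le (by norm_num), show m + 14 - 2 = m + 12 by omega]
    nlinarith
  have h3 : 4 * (overlapNumber G + 1) ≤ (m + 14) * (m + 12) := by
    rw [show m + 14 - 2 = m + 12 by omega] at h1 h2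
    omega
  have h4 : 4 * ((overlapNumber G : ℝ) + 1) ≤ ((m : ℝ) + 14) * (m + 12) := by exact_mod_cast h3
  rw [Int.le_floor]
  push_cast
  nlinarith
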